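/- **Corollary (finite function classes with completeness).** *Game.* Consider an episodic two-player zero-sum Markov game with horizon $H$, state space $\mathcal X$ (possibly infinite), action spaces $\mathcal A,\mathcal B$ of the max- and the min-player, transition kernels $\mathbb P_h(\cdot\mid x,a,b)$, deterministic rewards $r^h(x,a,b)\in[0,1]$ and a fixed initial state $x^1$. For Markov policies $\mu=(\mu_h)_h,\nu=(\nu_h)_h$ let $V_h^{\mu,\nu},Q_h^{\mu,\nu}$ be the usual value functions ($V_{H+1}^{\mu,\nu}=0$), and put $V_h^{\mu,\dagger}=\inf_\nu V_h^{\mu,\nu}$, $Q_h^{\mu,\dagger}=\inf_\nu Q_h^{\mu,\nu}$. Let $(\mu^*,\nu^*)$ be a Nash equilibrium, i.e. $V_h^{\mu,\nu^*}(x)\le V_h^{\mu^*,\nu^*}(x)\le V_h^{\mu^*,\nu}(x)$ for all $\mu,\nu,h,x$, and put $V^*=V^{\mu^*,\nu^*}$, $Q^*=Q^{\mu^*,\nu^*}$. *Function class.* Let $\mathcal F=\mathcal F_1\times\dots\times\mathcal F_H$ with finite sets $\mathcal F_h$ of functions $\mathcal X\times\mathcal A\times\mathcal B\to\mathbb R$,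 so $|\mathcal F|=\prod_h|\mathcal F_h|$. For $f\in\mathcal F$ put $f^{H+1}=0$ and $$V_{f,h}(x)=\max_{p}\min_{q}\,p^\top f^h(x,\cdot,\cdot)q,\qquad \mu_{f,h}(x)\in\operatorname*{argmax}_{p}\min_{q}\,p^\top f^h(x,\cdot,\cdot)q,$$ where $p,q$ range over the probability distributions on $\mathcal A$ and $\mathcal B$. For a policy $\mu$ put $V^\mu_{f,h}(x)=\min_q\mu_h(x)^\top f^h(x,\cdot,\cdot)q$, and for $f,g\in\mathcal F$ let $\nu_{f,g,h}(x)\in\operatorname*{argmin}_q\mu_{f,h}(x)^\top g^h(x,\cdot,\cdot)q$. (Ties are broken by a fixed rule, such that $\mu_{f,h}$ depends only on $h$ and $f^h$, and $\nu_{f,g,h}$ only on $h,f^h,g^h$.) Put $\mathcal T_h^\mu f(x,a,b)=r^h(x,a,b)+\mathbb E_{x'\sim\mathbb P_h(\cdot\mid x,a,b)}V^\mu_{f,h+1}(x')$ and $\mathcal E_h^\mu(f;x,a,b)=f^h(x,a,b)-\mathcal T_h^\mu f(x,a,b)$. Assume 1. (realizability) $Q_h^*\in\mathcal F_h$ and $Q_h^{\mu_f,\dagger}\in\mathcal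 F_h$ for all $f\in\mathcal F$, $h\in[H]$; 2. (completeness) $\mathcal T_h^{\mu_f}g\in\mathcal F_h$ for all $f,g\in\mathcal F$, $h\in[H]$; 3. (boundedness with $\beta=2$) every function in every $\mathcal F_h$ takes values in $[0,1]$. *Decoupling coefficient.* For $m>0$ let $dc(\mathcal F,MG,T,m)$ be the smallest integer $K\ge 0$ such that for all sequences $f_1,\dots,f_T$ and $g_1,\dots,g_T$ in $\mathcal F$, with $\pi_t=(\mu_{f_t},\nu_{f_t,g_t})$, and for both choices $(e_t)_t=(f_t)_t$ and $(e_t)_t=(g_t)_t$, $$\Bigl|\sum_{h=1}^H\sum_{t=1}^T\mathbb E_{\pi_t}\mathcal E_h^{\mu_{f_t}}(e_t;x^h,a^h,b^h)\Bigr|\le m\sum_{h=1}^H\sum_{t=1}^T\sum_{s=1}^{t-1}\mathbb E_{\pi_s}\bigl[\mathcal E_h^{\mu_{f_t}}(e_t;x^h,a^h,b^h)^2\bigr]+\frac{K}{4m}.$$ Let $dc(\mathcal F,MG,T)>0$ be any upper bound of $\sup_{0<m\le1}dc(\mathcal F,MG,T,m)$. *Algorithm (conditional posterior sampling with booster, uniform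 priors $p_0^h(\varphi)=1/|\mathcal F_h|$).* Let $S_{t-1}$ consist of the trajectories of episodes $1,\dots,t-1$. In episode $t$, draw $f_t\sim p(\cdot\mid S_{t-1})$, then $g_t\sim p^{\mu_{f_t}}(\cdot\mid S_{t-1})$, and execute $(\mu_t,\nu_t)=(\mu_{f_t},\nu_{f_t,g_t})$. Here $$p(f\mid S)\propto e^{\lambda V_{f,1}(x^1)}\prod_{h=1}^H\frac{p_0^h(f^h)e^{-\eta L^h(f^h,f^{h+1};S)}}{\mathbb E_{\varphi\sim p_0^h}e^{-\eta L^h(\varphi,f^{h+1};S)}},\qquad p^\mu(g\mid S)\propto e^{-\lambda V^\mu_{g,1}(x^1)}\prod_{h=1}^H\frac{p_0^h(g^h)e^{-\eta L^h_\mu(g^h,g^{h+1};S)}}{\mathbb E_{\varphi\sim p_0^h}e^{-\eta L^h_\mu(\varphi,g^{h+1};S)}},$$ $L^h(\varphi,f^{h+1};S)=\sum_s[\varphi(x_s^h,a_s^h,b_s^h)-r_s^h-V_{f,h+1}(x_s^{h+1})]^2$, and $L_\mu^h(\varphi,g^{h+1};S)$ is the same with $V^\mu_{g,h+1}$ in place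 of $V_{f,h+1}$; the sums are over the episodes $s$ in $S$. *Conclusion.* There is an absolute constant $C$ such that, for every such game, class and $T$, with $\eta=0.1$ and $\lambda=\sqrt{T\ln|\mathcal F|/dc(\mathcal F,MG,T)}$, $$\mathbb E\sum_{t=1}^T\bigl[V_1^*(x^1)-V_1^{\mu_t,\dagger}(x^1)\bigr]\le C\sqrt{dc(\mathcal F,MG,T)\,T\,\ln|\mathcal F|}.$$ -/

import Mathlib

open MeasureTheory ProbabilityTheory

namespace ZeroSumMG

/-- An episodic two-player zero-sum Markov game with deterministic rewards in `[0, 1]` and a fixed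
initial state. The steps `1, …, H` are numbered `0, …, H - 1`; data at indices `h ≥ H` are never
used. -/
structure MarkovGame (X A B : Type*) [MeasurableSpace X] [MeasurableSpace A]
    [MeasurableSpace B] where
  /-- length of an episode -/
  H : ℕ
  /-- transition kernels -/
  P : ℕ → Kernel (X × A × B) X
  isMarkov_P : ∀ h, IsMarkovKernel (P h)
  /-- rewards -/
  r : ℕ → X × A × B → ℝ
  measurable_r : ∀ h, Measurable (r h)
  r_nonneg : ∀ h s, 0 ≤ r h s
  r_le_one : ∀ h s, r h s ≤ 1
  /-- initial state -/
  x₁ : X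

/-- Markov (probability) kernels. -/
abbrev MKernel (X A : Type*) [MeasurableSpace X] [MeasurableSpace A] :=
  {κ : Kernel X A // IsMarkovKernel κ}

/-- Markov policies: a (measurable) map from states to distributions over actions, for each
step. -/
abbrev Policy (X A : Type*) [MeasurableSpace X] [MeasurableSpace A] := ℕ → MKernel X A

section Game

variable {X A B : Type*} [MeasurableSpace X] [MeasurableSpace A] [MeasurableSpace B]

/-! ### Trajectories and value functions -/

/-- The law of `n` consecutive steps `(x^h, a^h, b^h), …, (x^{h+n-1}, a^{h+n-1}, b^{h+n-1})`
under the policy pair `(μ, ν)`, started at step `h` in the state `x^h = x`. -/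
noncomputable def traj (M : MarkovGame X A B) (μ : Policy X A) (ν : Policy X B) :
    (n h : ℕ) → Kernel X (Fin n → X × A × B)
  | 0, _ => Kernel.deterministic (fun _ => Fin.elim0) measurable_const
  | n + 1, h =>
      ((Kernel.id ×ₖ (traj M μ ν n (h + 1) ∘ₖ M.P h)) ∘ₖ
        (Kernel.id ×ₖ ((μ h).1 ×ₖ (ν h).1))).map
          (fun p : (X × A × B) × (Fin n → X × A × B) =>
            (Fin.cons p.1 p.2 : Fin (n + 1) → X × A × B))

/-- The trajectories of one episode. -/
abbrev Trajectory (M : MarkovGame X A B) := Fin M.H → X × A × B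

/-- The law of the trajectory of an episode in which `(μ, ν)` is executed. -/
noncomputable def episodeLaw (M : MarkovGame X A B) (μ : Policy X A) (ν : Policy X B) :
    Measure (Trajectory M) :=
  traj M μ ν M.H 0 M.x₁

/-- `V_h^{μ,ν}(x)`: expected reward collected from step `h` on, given `x^h = x`. -/
noncomputable def value (M : MarkovGame X A B) (μ : Policy X A) (ν : Policy X B) (h : ℕ)
    (x : X) : ℝ :=
  ∫ ζ, ∑ i : Fin (M.H - h), M.r (h + i) (ζ i) ∂(traj M μ ν (M.H - h) h x)

/-- `Q_h^{μ,ν}(x, a, b)`, for steps `h < H`. -/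
noncomputable def qValue (M : MarkovGame X A B) (μ : Policy X A) (ν : Policy X B) (h : ℕ)
    (s : X × A × B) : ℝ :=
  M.r h s + ∫ x', value M μ ν (h + 1) x' ∂(M.P h s)

/-- `V_h^{μ,†}(x) = inf_ν V_h^{μ,ν}(x)`. -/
noncomputable def brValue (M : MarkovGame X A B) (μ : Policy X A) (h : ℕ) (x : X) : ℝ :=
  ⨅ ν : Policy X B, value M μ ν h x

/-- `Q_h^{μ,†}(x, a, b) = inf_ν Q_h^{μ,ν}(x, a, b)`. -/
noncomputable def brQValue (M : MarkovGame X A B) (μ : Policy X A) (h : ℕ) (s : X × A × B) : ℝ :=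
  ⨅ ν : Policy X B, qValue M μ ν h s

/-- `(μ, ν)` is a Nash equilibrium: at every step and state, neither player can gain by
deviating. -/
def IsNash (M : MarkovGame X A B) (μ : Policy X A) (ν : Policy X B) : Prop :=
  ∀ h < M.H, ∀ x,
    (∀ μ' : Policy X A, value M μ' ν h x ≤ value M μ ν h x) ∧
    (∀ ν' : Policy X B, value M μ ν h x ≤ value M μ ν' h x)

/-! ### Matrix games -/

/-- `p^⊤ G q`. -/
noncomputable def payoff (G : A → B → ℝ) (p : Measure A) (q : Measure B) : ℝ :=
  ∫ a, ∫ b, G a b ∂q ∂p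

/-- `min_q p^⊤ G q`. -/
noncomputable def minPayoff (G : A → B → ℝ) (p : Measure A) : ℝ :=
  ⨅ q : ProbabilityMeasure B, payoff G p q

/-- `max_p min_q p^⊤ G q`. -/
noncomputable def gameValue (G : A → B → ℝ) : ℝ :=
  ⨆ p : ProbabilityMeasure A, minPayoff G p

/-- `p ∈ argmax_{p'} min_q p'^⊤ G q`. -/
def IsMaximin (G : A → B → ℝ) (p : Measure A) : Prop :=
  ∀ p' : ProbabilityMeasure A, minPayoff G (p' : Measure A) ≤ minPayoff G p

/-- `q ∈ argmin_{q'} p^⊤ G q'`. -/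
def IsBestReply (G : A → B → ℝ) (p : Measure A) (q : Measure B) : Prop :=
  ∀ q' : ProbabilityMeasure B, payoff G p q ≤ payoff G p q'

/-! ### Function classes, induced policies, Bellman operators -/

/-- A finite function class `F = F_1 × ⋯ × F_H`, given by its factors. -/
abbrev FunClass (M : MarkovGame X A B) := Fin M.H → Finset (X × A × B → ℝ)

/-- The elements `f = (f^1, …, f^H)` of `F`. -/
def Mem {M : MarkovGame X A B} (F : FunClass M) := (h : Fin M.H) → {φ // φ ∈ F h}

instance {M : MarkovGame X A B} (F : FunClass M) : Fintype (Mem F) :=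
  inferInstanceAs (Fintype ((h : Fin M.H) → {φ // φ ∈ F h}))

instance {M : MarkovGame X A B} (F : FunClass M) : MeasurableSpace (Mem F) := ⊤

/-- The component `f^h`, which is `0` past the last step. -/
def Mem.comp {M : MarkovGame X A B} {F : FunClass M} (f : Mem F) (h : ℕ) : X × A × B → ℝ :=
  if hh : h < M.H then (f ⟨h, hh⟩).1 else 0

/-- `V_{f,h}(x) = max_μ min_ν μ^⊤ f^h(x,·,·) ν`. -/
noncomputable def inducedValue {M : MarkovGame X A B} {F : FunClass M} (f : Mem F) (h : ℕ)
    (x : X) : ℝ :=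
  gameValue fun a b => f.comp h (x, a, b)

/-- `V_{f,h}^μ(x) = min_ν μ_h(x)^⊤ f^h(x,·,·) ν`. -/
noncomputable def inducedBrValue {M : MarkovGame X A B} {F : FunClass M} (μ : Policy X A)
    (f : Mem F) (h : ℕ) (x : X) : ℝ :=
  minPayoff (fun a b => f.comp h (x, a, b)) ((μ h).1 x)

/-- `(𝒯_h^μ f)(x, a, b)`. -/
noncomputable def bellman {M : MarkovGame X A B} {F : FunClass M} (μ : Policy X A) (f : Mem F)
    (h : ℕ) (s : X × A × B) : ℝ :=
  M.r h s + ∫ x', inducedBrValue μ f (h + 1) x' ∂(M.P h s)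

/-- The Bellman residual `ℰ_h^μ(f; x, a, b)`. -/
noncomputable def residual {M : MarkovGame X A B} {F : FunClass M} (μ : Policy X A) (f : Mem F)
    (h : ℕ) (s : X × A × B) : ℝ :=
  f.comp h s - bellman μ f h s

/-- A rule that resolves the `argmax` and the `argmin` in the definition of the policies induced
by functions: `max h (f^h)` is `μ_{f,h}` and `min h (f^h) (g^h)` is `ν_{f,g,h}`. -/
structure Selector (X A B : Type*) [MeasurableSpace X] [MeasurableSpace A]
    [MeasurableSpace B] where
  max : ℕ → (X × A × B → ℝ) → MKernel X A
  min : ℕ → (X × A × B → ℝ) → (X × A × B → ℝ) → MKernel X B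

/-- The selected strategies are an `argmax` resp. an `argmin`. -/
structure Selector.IsOptimal (σ : Selector X A B) {M : MarkovGame X A B} (F : FunClass M) :
    Prop where
  max_isMaximin : ∀ h : Fin M.H, ∀ φ ∈ F h, ∀ x,
    IsMaximin (fun a b => φ (x, a, b)) ((σ.max h φ).1 x)
  min_isBestReply : ∀ h : Fin M.H, ∀ φ ∈ F h, ∀ ψ ∈ F h, ∀ x,
    IsBestReply (fun a b => ψ (x, a, b)) ((σ.max h φ).1 x) ((σ.min h φ ψ).1 x)

/-- `μ_f`. -/
def Selector.maxPolicy (σ : Selector X A B) {M : MarkovGame X A B} {F : FunClass M}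
    (f : Mem F) : Policy X A :=
  fun h => σ.max h (f.comp h)

/-- `ν_{f,g}`. -/
def Selector.minPolicy (σ : Selector X A B) {M : MarkovGame X A B} {F : FunClass M}
    (f g : Mem F) : Policy X B :=
  fun h => σ.min h (f.comp h) (g.comp h)

/-! ### Assumptions on the function class -/

/-- `Q_h^* ∈ F_h`, and `Q_h^{μ_f,†} ∈ F_h` for all `f ∈ F`, where `Q^* = Q^{μ^*,ν^*}`. -/
def Realizable {M : MarkovGame X A B} (F : FunClass M) (σ : Selector X A B)
    (μs : Policy X A) (νs : Policy X B) : Prop :=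
  ∀ h : Fin M.H, qValue M μs νs h ∈ F h ∧ ∀ f : Mem F, brQValue M (σ.maxPolicy f) h ∈ F h

/-- `𝒯_h^{μ_f} g ∈ F_h` for all `f, g ∈ F`. -/
def Complete {M : MarkovGame X A B} (F : FunClass M) (σ : Selector X A B) : Prop :=
  ∀ f g : Mem F, ∀ h : Fin M.H, bellman (σ.maxPolicy f) g h ∈ F h

/-- All functions take values in `[0, β - 1]`. -/
def BoundedBy {M : MarkovGame X A B} (F : FunClass M) (β : ℝ) : Prop :=
  ∀ h : Fin M.H, ∀ φ ∈ F h, ∀ s, 0 ≤ φ s ∧ φ s ≤ β - 1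

/-! ### The multi-agent decoupling coefficient -/

/-- The inequality that defines the decoupling coefficient, for functions `f_t, g_t ∈ F` that
induce `π_t = (μ_{f_t}, ν_{f_t,g_t})` and for the `𝒯^{μ_{f_t}}`-residuals of `e_t ∈ F`. -/
def DecouplingIneq {M : MarkovGame X A B} {F : FunClass M} (σ : Selector X A B) (T : ℕ)
    (m K : ℝ) (f g e : ℕ → Mem F) : Prop :=
  |∑ h : Fin M.H, ∑ t ∈ Finset.range T,
      ∫ ζ, residual (σ.maxPolicy (f t)) (e t) h (ζ h)
        ∂(episodeLaw M (σ.maxPolicy (f t)) (σ.minPolicy (f t) (g t)))| ≤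
    m * ∑ h : Fin M.H, ∑ t ∈ Finset.range T, ∑ s ∈ Finset.range t,
      ∫ ζ, (residual (σ.maxPolicy (f t)) (e t) h (ζ h)) ^ 2
        ∂(episodeLaw M (σ.maxPolicy (f s)) (σ.minPolicy (f s) (g s))) + K / (4 * m)

/-- `dc(F, MG, T, m)`: the least integer `K` such that the decoupling inequality holds for all
sequences in `F`, both for the residuals of the `f_t` (for which `𝒯^{μ_{f_t}} f_t = 𝒯 f_t`) and
for those of the `g_t`. -/
noncomputable def dc {M : MarkovGame X A B} (F : FunClass M) (σ : Selector X A B) (T : ℕ)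
    (m : ℝ) : ℕ :=
  sInf {K : ℕ | ∀ f g : ℕ → Mem F,
    DecouplingIneq σ T m K f g f ∧ DecouplingIneq σ T m K f g g}

/-! ### Conditional posterior sampling with booster, with uniform priors -/

/-- `∑_s [φ(x_s^h, a_s^h, b_s^h) - r_s^h - v_{h+1}(x_s^{h+1})]^2`, where `v_{H+1} = 0`. -/
noncomputable def loss (M : MarkovGame X A B) (v : ℕ → X → ℝ) (h : ℕ) (φ : X × A × B → ℝ)
    {t : ℕ} (S : Fin t → Trajectory M) : ℝ :=
  if hh : h < M.H then
    ∑ s : Fin t, (φ (S s ⟨h, hh⟩) - M.r h (S s ⟨h, hh⟩) -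
      if hh' : h + 1 < M.H then v (h + 1) (S s ⟨h + 1, hh'⟩).1 else 0) ^ 2
  else 0

/-- `∏_h p_0^h(f^h) exp(-η L^h(f^h)) / E_{φ ∼ p_0^h} exp(-η L^h(φ))` with `p_0^h` uniform on
`F_h`; the losses `L^h` use the next-step values `v`. -/
noncomputable def condProd {M : MarkovGame X A B} {F : FunClass M} (η : ℝ) (v : ℕ → X → ℝ)
    (f : Mem F) {t : ℕ} (S : Fin t → Trajectory M) : ℝ :=
  ∏ h : Fin M.H,
    (1 / ((F h).card : ℝ) * Real.exp (-η * loss M v h (f.comp h) S)) /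
      ∑ φ ∈ F h, 1 / ((F h).card : ℝ) * Real.exp (-η * loss M v h φ S)

/-- The posterior of the main agent, up to normalization. -/
noncomputable def mainWeight {M : MarkovGame X A B} {F : FunClass M} (η l : ℝ)
    {t : ℕ} (S : Fin t → Trajectory M) (f : Mem F) : ℝ :=
  Real.exp (l * inducedValue f 0 M.x₁) * condProd η (inducedValue f) f S

/-- The posterior `p(f | S)` of the main agent. -/
noncomputable def mainPosterior {M : MarkovGame X A B} {F : FunClass M} (η l : ℝ)
    {t : ℕ} (S : Fin t → Trajectory M) (f : Mem F) : ℝ :=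
  mainWeight η l S f / ∑ f' : Mem F, mainWeight η l S f'

/-- The posterior of the booster agent against `μ`, up to normalization. -/
noncomputable def boosterWeight {M : MarkovGame X A B} {F : FunClass M} (η l : ℝ)
    (μ : Policy X A) {t : ℕ} (S : Fin t → Trajectory M) (g : Mem F) : ℝ :=
  Real.exp (-l * inducedBrValue μ g 0 M.x₁) * condProd η (inducedBrValue μ g) g S

/-- The posterior `p^μ(g | S)` of the booster agent. -/
noncomputable def boosterPosterior {M : MarkovGame X A B} {F : FunClass M} (η l : ℝ)
    (μ : Policy X A) {t : ℕ} (S : Fin t → Trajectory M) (g : Mem F) : ℝ :=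
  boosterWeight η l μ S g / ∑ g' : Mem F, boosterWeight η l μ S g'

/-- What happens in one episode: the sampled functions `f_t`, `g_t` and the trajectory `ζ_t`. -/
abbrev Episode {M : MarkovGame X A B} (F : FunClass M) := Mem F × Mem F × Trajectory M

/-- The joint law of the first `t` episodes. Given the past, `f_{t+1}` is drawn from the main
agent's posterior, then `g_{t+1}` from the booster agent's posterior against `μ_{f_{t+1}}`, and
then the trajectory from executing `(μ_{f_{t+1}}, ν_{f_{t+1},g_{t+1}})`. -/
noncomputable def processLaw {M : MarkovGame X A B} (F : FunClass M) (σ : Selector X A B)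
    (η l : ℝ) : (t : ℕ) → Measure (Fin t → Episode F)
  | 0 => Measure.dirac Fin.elim0
  | t + 1 => ∑ f : Mem F, ∑ g : Mem F,
      ((((processLaw F σ η l t).withDensity fun ω =>
          ENNReal.ofReal (mainPosterior η l (fun s => (ω s).2.2) f *
            boosterPosterior η l (σ.maxPolicy f) (fun s => (ω s).2.2) g)).prod
        (episodeLaw M (σ.maxPolicy f) (σ.minPolicy f g))).map
          (fun p : (Fin t → Episode F) × Trajectory M =>
            (Fin.snoc p.1 ((f, g, p.2) : Episode F) : Fin (t + 1) → Episode F)))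

/-- The expected regret of the max-player over `T` episodes,
`E ∑_{t ≤ T} [V_1^*(x^1) - V_1^{μ_t,†}(x^1)]`, where `V^* = V^{μ^*,ν^*}`. -/
noncomputable def expectedRegret {M : MarkovGame X A B} (F : FunClass M) (σ : Selector X A B)
    (μs : Policy X A) (νs : Policy X B) (η l : ℝ) (T : ℕ) : ℝ :=
  ∫ ω, ∑ t : Fin T,
    (value M μs νs 0 M.x₁ - brValue M (σ.maxPolicy (ω t).1) 0 M.x₁) ∂(processLaw F σ η l T)

end Game

end ZeroSumMG

open ZeroSumMG

/-!
For a fixed regression problem the exponentiated excess losses form a supermartingale along the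
learning process. So the expected log-potentials, which bound the logarithms of the normalizers in
the posteriors, are `O(log |F|)`: completeness puts the regression target into the class.
By the Gibbs variational principle, comparison with the solutions of the Bellman equations
(realizability) then bounds, in each round, the posterior mean of the value gaps plus the in-sample
squared Bellman residuals. The gap that remains to the regret is a difference of on-policy Bellman
residuals, which the decoupling coefficient trades for the same in-sample squares.
-/

namespace ZeroSumMG

/-! ### Bounded measurable functions -/

/-- Bounded measurable real functions: they are integrable against every finite measure and are
preserved by averaging over a Markov kernel. -/
structure BddMeas {α : Type*} [MeasurableSpace α] (f : α → ℝ) : Prop where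
  measurable : Measurable f
  exists_abs_le : ∃ C, ∀ x, |f x| ≤ C

namespace BddMeas

variable {α β ι : Type*} [MeasurableSpace α] [MeasurableSpace β] {f g : α → ℝ}

lemma of_mem_Icc (hf : Measurable f) {a b : ℝ} (h : ∀ x, f x ∈ Set.Icc a b) : BddMeas f :=
  ⟨hf, max |a| |b|, fun x => abs_le_max_abs_abs (h x).1 (h x).2⟩

lemma of_finite [Finite α] [DiscreteMeasurableSpace α] (f : α → ℝ) : BddMeas f :=
  ⟨.of_discrete, (Set.finite_range fun x => |f x|).bddAbove.imp fun _ h x => h ⟨x, rfl⟩⟩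

lemma const (c : ℝ) : BddMeas fun _ : α => c :=
  ⟨measurable_const, |c|, fun _ => le_rfl⟩

lemma integrable (hf : BddMeas f) (μ : Measure α) [IsFiniteMeasure μ] : Integrable f μ := by
  obtain ⟨C, hC⟩ := hf.exists_abs_le
  exact Integrable.of_bound hf.measurable.aestronglyMeasurable C (ae_of_all _ hC)

lemma add (hf : BddMeas f) (hg : BddMeas g) : BddMeas fun x => f x + g x := by
  obtain ⟨C, hC⟩ := hf.exists_abs_le
  obtain ⟨D, hD⟩ := hg.exists_abs_le
  exact ⟨hf.measurable.add hg.measurable, C + D,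
    fun x => (abs_add_le _ _).trans (add_le_add (hC x) (hD x))⟩

lemma mul (hf : BddMeas f) (hg : BddMeas g) : BddMeas fun x => f x * g x := by
  obtain ⟨C, hC⟩ := hf.exists_abs_le
  obtain ⟨D, hD⟩ := hg.exists_abs_le
  refine ⟨hf.measurable.mul hg.measurable, C * D, fun x => ?_⟩
  rw [abs_mul]
  exact mul_le_mul (hC x) (hD x) (abs_nonneg _) ((abs_nonneg _).trans (hC x))

lemma const_mul (c : ℝ) (hf : BddMeas f) : BddMeas fun x => c * f x :=
  (const c).mul hf

lemma neg (hf : BddMeas f) : BddMeas fun x => -f x := by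
  simpa only [neg_one_mul] using hf.const_mul (-1)

lemma sub (hf : BddMeas f) (hg : BddMeas g) : BddMeas fun x => f x - g x := by
  simpa only [sub_eq_add_neg] using hf.add hg.neg

lemma pow (hf : BddMeas f) (n : ℕ) : BddMeas fun x => f x ^ n := by
  obtain ⟨C, hC⟩ := hf.exists_abs_le
  refine ⟨hf.measurable.pow_const n, C ^ n, fun x => ?_⟩
  rw [abs_pow]
  exact pow_le_pow_left₀ (abs_nonneg _) (hC x) n

lemma exp (hf : BddMeas f) : BddMeas fun x => Real.exp (f x) := by
  obtain ⟨C, hC⟩ := hf.exists_abs_le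
  refine ⟨hf.measurable.exp, Real.exp C, fun x => ?_⟩
  rw [abs_of_pos (Real.exp_pos _)]
  exact Real.exp_le_exp.2 ((le_abs_self _).trans (hC x))

lemma sum {s : Finset ι} {f : ι → α → ℝ} (hf : ∀ i ∈ s, BddMeas (f i)) :
    BddMeas fun x => ∑ i ∈ s, f i x := by
  choose! C hC using fun i hi => (hf i hi).exists_abs_le
  exact ⟨Finset.measurable_fun_sum s fun i hi => (hf i hi).measurable, ∑ i ∈ s, C i,
    fun x => (Finset.abs_sum_le_sum_abs _ _).trans (Finset.sum_le_sum fun i hi => hC i hi x)⟩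

lemma comp (hf : BddMeas f) {u : β → α} (hu : Measurable u) : BddMeas fun y => f (u y) :=
  ⟨hf.measurable.comp hu, hf.exists_abs_le.imp fun _ hC _ => hC _⟩

lemma integral_kernel {f : α × β → ℝ} (hf : BddMeas f) (κ : Kernel α β) [IsMarkovKernel κ] :
    BddMeas fun x => ∫ y, f (x, y) ∂(κ x) := by
  obtain ⟨C, hC⟩ := hf.exists_abs_le
  refine ⟨(hf.measurable.stronglyMeasurable.integral_kernel_prod_right' (κ := κ)).measurable, C,
    fun x => ?_⟩
  simpa only [Real.norm_eq_abs, probReal_univ, mul_one] using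
    norm_integral_le_of_norm_le_const (μ := κ x) (f := fun y => f (x, y))
      (ae_of_all _ fun y => hC (x, y))

lemma integral_kernel' {f : β → ℝ} (hf : BddMeas f) (κ : Kernel α β) [IsMarkovKernel κ] :
    BddMeas fun x => ∫ y, f y ∂(κ x) :=
  (hf.comp measurable_snd).integral_kernel κ

end BddMeas

lemma integral_id_prod {α β : Type*} [MeasurableSpace α] [MeasurableSpace β] (κ : Kernel α β)
    [IsMarkovKernel κ] (x : α) {f : α × β → ℝ} (hf : BddMeas f) :
    ∫ p, f p ∂((Kernel.id ×ₖ κ) x) = ∫ y, f (x, y) ∂(κ x) := by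
  rw [Kernel.prod_apply, Kernel.id_apply, integral_prod _ (hf.integrable _)]
  exact integral_dirac' _ _
    (hf.integral_kernel (Kernel.const α (κ x))).measurable.stronglyMeasurable

lemma measurable_finCons {Z : Type*} [MeasurableSpace Z] (n : ℕ) :
    Measurable fun p : Z × (Fin n → Z) => (Fin.cons p.1 p.2 : Fin (n + 1) → Z) := by
  refine measurable_pi_iff.2 (Fin.cases ?_ fun j => ?_)
  · exact measurable_fst
  · exact (measurable_pi_apply j).comp measurable_snd

lemma integral_mem_Icc_of_forall {α : Type*} [MeasurableSpace α] {P : Measure α}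
    [IsProbabilityMeasure P] {φ : α → ℝ} (hφ : Measurable φ) {a b : ℝ}
    (h : ∀ x, φ x ∈ Set.Icc a b) : ∫ x, φ x ∂P ∈ Set.Icc a b :=
  (convex_Icc a b).integral_mem isClosed_Icc (ae_of_all _ h)
    ((BddMeas.of_mem_Icc hφ h).integrable P)

/-! ### Exponential moments -/

lemma integral_exp_sq_sub_sq_le {α : Type*} [MeasurableSpace α] (P : Measure α)
    [IsProbabilityMeasure P] {v : α → ℝ} (hv : Measurable v) (h01 : ∀ x, v x ∈ Set.Icc (0 : ℝ) 1)
    (η e : ℝ) :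
    ∫ x, Real.exp (-η * ((e + (∫ y, v y ∂P - v x)) ^ 2 - (∫ y, v y ∂P - v x) ^ 2)) ∂P ≤
      Real.exp (-(η - η ^ 2 / 2) * e ^ 2) := by
  have hoeffding := (hasSubgaussianMGF_of_mem_Icc hv.aemeasurable (ae_of_all P h01)).mgf_le
    (2 * η * e)
  calc ∫ x, Real.exp (-η * ((e + (∫ y, v y ∂P - v x)) ^ 2 - (∫ y, v y ∂P - v x) ^ 2)) ∂P
      = Real.exp (-η * e ^ 2) * ∫ x, Real.exp (2 * η * e * (v x - ∫ y, v y ∂P)) ∂P := by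
        rw [← integral_const_mul]
        congr! 2
        rw [← Real.exp_add]
        ring_nf
    _ ≤ Real.exp (-η * e ^ 2) * Real.exp (η ^ 2 * e ^ 2 / 2) := by
        refine mul_le_mul_of_nonneg_left (hoeffding.trans_eq ?_) (Real.exp_pos _).le
        norm_num
        ring
    _ = Real.exp (-(η - η ^ 2 / 2) * e ^ 2) := by
        rw [← Real.exp_add]
        ring_nf

lemma exp_neg_le_one_sub_add_sq_div_two {x : ℝ} (hx : 0 ≤ x) :
    Real.exp (-x) ≤ 1 - x + x ^ 2 / 2 := by
  rw [Real.exp_neg]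
  refine inv_le_of_inv_le₀ (by nlinarith [sq_nonneg (x - 1)]) (le_trans ?_
    (Real.quadratic_le_exp_of_nonneg hx))
  rw [inv_le_iff_one_le_mul₀ (by nlinarith [sq_nonneg (x - 1)])]
  nlinarith [sq_nonneg (x ^ 2)]

lemma integral_exp_neg_mul_sq_le {α : Type*} [MeasurableSpace α] (P : Measure α)
    [IsProbabilityMeasure P] {e : α → ℝ} (he : Measurable e) (h2 : ∀ x, |e x| ≤ 2) {c : ℝ}
    (hc : 0 ≤ c) :
    ∫ x, Real.exp (-c * e x ^ 2) ∂P ≤ Real.exp (-(c * (1 - 2 * c)) * ∫ x, e x ^ 2 ∂P) := by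
  have hsq : BddMeas fun x => e x ^ 2 := .pow ⟨he, 2, h2⟩ 2
  have pointwise (x : α) : Real.exp (-c * e x ^ 2) ≤ 1 + -(c * (1 - 2 * c)) * e x ^ 2 := by
    have h4 : e x ^ 2 ≤ 4 := by
      rw [← sq_abs]
      nlinarith [h2 x, abs_nonneg (e x)]
    have := exp_neg_le_one_sub_add_sq_div_two (mul_nonneg hc (sq_nonneg (e x)))
    rw [neg_mul]
    nlinarith [mul_nonneg (sq_nonneg c) (mul_nonneg (sq_nonneg (e x)) (sub_nonneg.2 h4))]
  calc ∫ x, Real.exp (-c * e x ^ 2) ∂P ≤ ∫ x, (1 + -(c * (1 - 2 * c)) * e x ^ 2) ∂P :=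
        integral_mono ((hsq.const_mul _).exp.integrable P)
          (((BddMeas.const 1).add (hsq.const_mul _)).integrable P) pointwise
    _ = -(c * (1 - 2 * c)) * ∫ x, e x ^ 2 ∂P + 1 := by
        rw [integral_add (integrable_const _) ((hsq.const_mul _).integrable P),
          integral_const_mul, integral_const, probReal_univ, one_smul, add_comm]
    _ ≤ _ := Real.add_one_le_exp _

/-! ### Gibbs distributions on finite sets -/

section Gibbs

variable {ι : Type*} [Fintype ι]

lemma sum_negMulLog_le_log_card [Nonempty ι] {p : ι → ℝ} (h0 : ∀ i, 0 ≤ p i)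
    (h1 : ∑ i, p i = 1) : ∑ i, Real.negMulLog (p i) ≤ Real.log (Fintype.card ι) := by
  have hN : (0 : ℝ) < Fintype.card ι := Nat.cast_pos.2 Fintype.card_pos
  have jensen := Real.concaveOn_negMulLog.le_map_sum (t := Finset.univ)
    (w := fun _ : ι => (Fintype.card ι : ℝ)⁻¹) (p := p) (fun _ _ => (inv_pos.2 hN).le)
    (by simp only [Finset.sum_const, Finset.card_univ, nsmul_eq_mul, mul_inv_cancel₀ hN.ne'])
    (fun i _ => h0 i)
  simp only [smul_eq_mul, ← Finset.mul_sum, h1, mul_one, Real.negMulLog, Real.log_inv,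
    neg_mul_neg] at jensen
  exact le_of_mul_le_mul_left jensen (inv_pos.2 hN)

/-- The probability weights on a finite type that are proportional to `w`. -/
noncomputable def normalize (w : ι → ℝ) (i : ι) : ℝ :=
  w i / ∑ k, w k

variable {w : ι → ℝ} (hw : ∀ i, 0 < w i)

include hw

lemma normalize_pos (i : ι) : 0 < normalize w i :=
  div_pos (hw i) (Finset.sum_pos (fun k _ => hw k) ⟨i, Finset.mem_univ i⟩)

lemma sum_normalize [Nonempty ι] : ∑ i, normalize w i = 1 := by
  simp only [normalize, ← Finset.sum_div]
  exact div_self (Finset.sum_pos (fun k _ => hw k) Finset.univ_nonempty).ne'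

lemma normalize_le_one (i : ι) : normalize w i ≤ 1 :=
  have : Nonempty ι := ⟨i⟩
  (Finset.single_le_sum (fun k _ => (normalize_pos hw k).le) (Finset.mem_univ i)).trans_eq
    (sum_normalize hw)

/-- The Gibbs variational principle: `normalize w` minimizes the expected energy `-log w` minus
entropy, so comparing with the point mass at `j` costs at most the maximal entropy. -/
lemma sum_normalize_mul_neg_log_le (j : ι) :
    ∑ i, normalize w i * -Real.log (w i) ≤ -Real.log (w j) + Real.log (Fintype.card ι) := by
  have : Nonempty ι := ⟨j⟩
  have hW : 0 < ∑ k, w k := Finset.sum_pos (fun k _ => hw k) Finset.univ_nonempty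
  have energy (i : ι) : normalize w i * -Real.log (w i) =
      Real.negMulLog (normalize w i) - normalize w i * Real.log (∑ k, w k) := by
    rw [Real.negMulLog, normalize, Real.log_div (hw i).ne' hW.ne']
    ring
  have hj : Real.log (w j) ≤ Real.log (∑ k, w k) :=
    Real.log_le_log (hw j) (Finset.single_le_sum (fun k _ => (hw k).le) (Finset.mem_univ j))
  simp only [energy, Finset.sum_sub_distrib, ← Finset.sum_mul, sum_normalize hw, one_mul]
  linarith [sum_negMulLog_le_log_card (fun i => (normalize_pos hw i).le) (sum_normalize hw)]

lemma sum_normalize_mul_le {G : ι → ℝ} {a b : ℝ} (hG : ∀ i, G i ≤ -Real.log (w i) + a) (j : ι)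
    (hj : -Real.log (w j) ≤ b) :
    ∑ i, normalize w i * G i ≤ a + b + Real.log (Fintype.card ι) := by
  have : Nonempty ι := ⟨j⟩
  calc ∑ i, normalize w i * G i ≤ ∑ i, normalize w i * (-Real.log (w i) + a) :=
        Finset.sum_le_sum fun i _ => mul_le_mul_of_nonneg_left (hG i) (normalize_pos hw i).le
    _ = ∑ i, normalize w i * -Real.log (w i) + a := by
        simp only [mul_add, Finset.sum_add_distrib, ← Finset.sum_mul, sum_normalize hw, one_mul]
    _ ≤ _ := by linarith [sum_normalize_mul_neg_log_le hw j]

end Gibbs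

lemma bddMeas_normalize {α ι : Type*} [MeasurableSpace α] [Fintype ι] {w : α → ι → ℝ}
    (hpos : ∀ x i, 0 < w x i) (hw : ∀ i, Measurable fun x => w x i) (i : ι) :
    BddMeas fun x => normalize (w x) i :=
  .of_mem_Icc ((hw i).div (Finset.measurable_fun_sum _ fun k _ => hw k))
    fun x => ⟨(normalize_pos (hpos x) i).le, normalize_le_one (hpos x) i⟩

lemma log_le_log_add_div_sub_one {a b : ℝ} (ha : 0 < a) (hb : 0 < b) :
    Real.log a ≤ Real.log b + a / b - 1 := by
  have := Real.log_le_sub_one_of_pos (div_pos ha hb)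
  rw [Real.log_div ha.ne' hb.ne'] at this
  linarith

variable {X A B : Type*} [MeasurableSpace X] [MeasurableSpace A] [MeasurableSpace B]

/-! ### Integration along trajectories -/

instance (κ : MKernel X A) : IsMarkovKernel κ.1 := κ.2

instance (M : MarkovGame X A B) (h : ℕ) : IsMarkovKernel (M.P h) := M.isMarkov_P h

section Trajectory

variable (M : MarkovGame X A B) (μ : Policy X A) (ν : Policy X B)

instance isMarkovKernel_traj : ∀ n h, IsMarkovKernel (traj M μ ν n h)
  | 0, h => by
    unfold traj
    infer_instance
  | n + 1, h => by
    have := isMarkovKernel_traj n (h + 1)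
    unfold traj
    exact Kernel.IsMarkovKernel.map _ (measurable_finCons n)

instance : IsProbabilityMeasure (episodeLaw M μ ν) := by
  unfold episodeLaw
  infer_instance

lemma integral_traj_succ (n h : ℕ) (x : X) {f : (Fin (n + 1) → X × A × B) → ℝ} (hf : BddMeas f) :
    ∫ ζ, f ζ ∂(traj M μ ν (n + 1) h x) =
      ∫ c, ∫ x', ∫ ζ, f (Fin.cons (x, c) ζ) ∂(traj M μ ν n (h + 1) x') ∂(M.P h (x, c))
        ∂(((μ h).1 ×ₖ (ν h).1) x) := by
  have hcons := measurable_finCons (Z := X × A × B) n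
  have hf_cons : BddMeas fun p : (X × A × B) × (Fin n → X × A × B) =>
      f (Fin.cons p.1 p.2 : Fin (n + 1) → X × A × B) := hf.comp hcons
  have integral_tail (z : X × A × B) :
      ∫ p, f (Fin.cons p.1 p.2 : Fin (n + 1) → X × A × B)
        ∂((Kernel.id ×ₖ (traj M μ ν n (h + 1) ∘ₖ M.P h)) z) =
      ∫ x', ∫ ζ, f (Fin.cons z ζ) ∂(traj M μ ν n (h + 1) x') ∂(M.P h z) := by
    rw [integral_id_prod _ _ hf_cons, Kernel.integral_comp]
    exact (hf_cons.comp (measurable_const.prodMk measurable_id)).integrable _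
  have bddMeas_tail : BddMeas fun q : (X × A × B) × X =>
      ∫ ζ, f (Fin.cons q.1 ζ) ∂(traj M μ ν n (h + 1) q.2) :=
    BddMeas.integral_kernel (f := fun q : ((X × A × B) × X) × (Fin n → X × A × B) =>
      f (Fin.cons q.1.1 q.2)) (hf_cons.comp (u := fun q : ((X × A × B) × X) ×
        (Fin n → X × A × B) => (q.1.1, q.2)) (by fun_prop))
      ((traj M μ ν n (h + 1)).comap Prod.snd measurable_snd)
  rw [traj, Kernel.map_apply _ hcons, integral_map hcons.aemeasurable
    hf.measurable.aestronglyMeasurable, Kernel.integral_comp (hf_cons.integrable _)]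
  simp_rw [integral_tail]
  exact integral_id_prod _ _ (bddMeas_tail.integral_kernel (M.P h))

lemma integral_traj_next_state (n h : ℕ) (x : X) (i : ℕ) (hi : i + 1 < n)
    {G : (X × A × B) × X → ℝ} (hG : BddMeas G) :
    ∫ ζ, G (ζ ⟨i, by omega⟩, (ζ ⟨i + 1, hi⟩).1) ∂(traj M μ ν n h x) =
      ∫ ζ, ∫ x', G (ζ ⟨i, by omega⟩, x') ∂(M.P (h + i) (ζ ⟨i, by omega⟩))
        ∂(traj M μ ν n h x) := by
  induction i generalizing n h x with
  | zero =>
    obtain ⟨n, rfl⟩ : ∃ k, n = k + 2 := ⟨n - 2, by omega⟩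
    have cons_zero (z : X × A × B) (ζ : Fin (n + 1) → X × A × B) :
      (Fin.cons z ζ : Fin (n + 2) → X × A × B) ⟨0, by omega⟩ = z := rfl
    have cons_one (z : X × A × B) (ζ : Fin (n + 1) → X × A × B) :
      (Fin.cons z ζ : Fin (n + 2) → X × A × B) ⟨0 + 1, by omega⟩ = ζ 0 := rfl
    rw [integral_traj_succ _ _ _ _ _ _ (hG.comp (by fun_prop)),
      integral_traj_succ _ _ _ _ _ _ ((hG.integral_kernel _).comp (by fun_prop))]
    simp only [cons_zero, cons_one, integral_const, probReal_univ, one_smul, add_zero]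
    congr! with c x'
    rw [integral_traj_succ _ _ _ _ _ _ (hG.comp (by fun_prop))]
    simp only [Fin.cons_zero, integral_const, probReal_univ, one_smul]
  | succ i ih =>
    obtain ⟨n, rfl⟩ : ∃ k, n = k + 1 := ⟨n - 1, by omega⟩
    rw [integral_traj_succ _ _ _ _ _ _ (hG.comp (by fun_prop)),
      integral_traj_succ _ _ _ _ _ _ ((hG.integral_kernel _).comp (by fun_prop))]
    congr! 4 with c x'
    have := ih n (h + 1) x' (by omega)
    rwa [show h + 1 + i = h + (i + 1) by omega] at this

variable {M μ ν} in
lemma traj_congr {μ' : Policy X A} {ν' : Policy X B} (n h : ℕ)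
    (hμ : ∀ k, h ≤ k → μ k = μ' k) (hν : ∀ k, h ≤ k → ν k = ν' k) :
    traj M μ ν n h = traj M μ' ν' n h := by
  induction n generalizing h with
  | zero => rfl
  | succ n ih =>
    simp only [traj, hμ h le_rfl, hν h le_rfl, ih (h + 1) (fun k hk => hμ k (by omega))
      fun k hk => hν k (by omega)]

/-- The expected sum of `ρ` over `n` consecutive steps, started at step `h` in the state `x`: the
common form of the value functions and of the sums of Bellman residuals. -/
noncomputable def trajSum (ρ : ℕ → X × A × B → ℝ) (n h : ℕ) (x : X) : ℝ :=
  ∫ ζ, ∑ i : Fin n, ρ (h + i) (ζ i) ∂(traj M μ ν n h x)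

variable {M μ ν} {ρ ρ' : ℕ → X × A × B → ℝ}

lemma bddMeas_traj_sum (hρ : ∀ k, BddMeas (ρ k)) (n h : ℕ) :
    BddMeas fun ζ : Fin n → X × A × B => ∑ i : Fin n, ρ (h + i) (ζ i) :=
  BddMeas.sum fun i _ => (hρ (h + i)).comp (measurable_pi_apply i)

lemma bddMeas_trajSum (hρ : ∀ k, BddMeas (ρ k)) (n h : ℕ) : BddMeas (trajSum M μ ν ρ n h) :=
  (bddMeas_traj_sum hρ n h).integral_kernel' _

lemma trajSum_zero (h : ℕ) (x : X) : trajSum M μ ν ρ 0 h x = 0 := by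
  simp only [trajSum, Finset.univ_eq_empty, Finset.sum_empty, integral_zero]

lemma trajSum_succ (hρ : ∀ k, BddMeas (ρ k)) (n h : ℕ) (x : X) :
    trajSum M μ ν ρ (n + 1) h x =
      ∫ c, (ρ h (x, c) + ∫ x', trajSum M μ ν ρ n (h + 1) x' ∂(M.P h (x, c)))
        ∂(((μ h).1 ×ₖ (ν h).1) x) := by
  have sum_cons (z : X × A × B) (ζ : Fin n → X × A × B) :
      ∑ i : Fin (n + 1), ρ (h + i) ((Fin.cons z ζ : Fin (n + 1) → X × A × B) i) =
        ρ h z + ∑ i : Fin n, ρ (h + 1 + i) (ζ i) := by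
    rw [Fin.sum_univ_succ]
    congr! 3 with i
    simp only [Fin.val_succ]
    omega
  rw [trajSum, integral_traj_succ M μ ν n h x (bddMeas_traj_sum hρ (n + 1) h)]
  simp_rw [sum_cons]
  congr! 2 with c
  simp_rw [integral_add (integrable_const _) ((bddMeas_traj_sum hρ n (h + 1)).integrable _),
    integral_const, probReal_univ, one_smul]
  refine (integral_add (integrable_const _)
    ((bddMeas_trajSum hρ n (h + 1)).integrable _)).trans ?_
  simp only [integral_const, probReal_univ, one_smul]

lemma trajSum_add (hρ : ∀ k, BddMeas (ρ k)) (hρ' : ∀ k, BddMeas (ρ' k)) (n h : ℕ) (x : X) :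
    trajSum M μ ν (fun k s => ρ k s + ρ' k s) n h x =
      trajSum M μ ν ρ n h x + trajSum M μ ν ρ' n h x := by
  simp only [trajSum, Finset.sum_add_distrib]
  exact integral_add ((bddMeas_traj_sum hρ n h).integrable _)
    ((bddMeas_traj_sum hρ' n h).integrable _)

lemma trajSum_neg (n h : ℕ) (x : X) :
    trajSum M μ ν (fun k s => -ρ k s) n h x = -trajSum M μ ν ρ n h x := by
  simp only [trajSum, Finset.sum_neg_distrib, integral_neg]

lemma trajSum_episode (hρ : ∀ k, BddMeas (ρ k)) :
    trajSum M μ ν ρ M.H 0 M.x₁ = ∑ h : Fin M.H, ∫ ζ, ρ h (ζ h) ∂(episodeLaw M μ ν) := by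
  simp only [trajSum, zero_add]
  exact integral_finsetSum _ fun i _ =>
    ((hρ i).comp (measurable_pi_apply i)).integrable (episodeLaw M μ ν)

/-- A one-sided Bellman inequality for `v` telescopes along trajectories. -/
lemma le_trajSum {v : ℕ → X → ℝ} {g : ℕ → X × A × B → ℝ} (hv : ∀ k, BddMeas (v k))
    (hg : ∀ k, BddMeas (g k)) (hle : ∀ k x, v k x ≤ ∫ c, g k (x, c) ∂(((μ k).1 ×ₖ (ν k).1) x))
    (n h : ℕ) (hend : ∀ x, v (h + n) x ≤ 0) (x : X) :
    v h x ≤ trajSum M μ ν (fun k s => g k s - ∫ x', v (k + 1) x' ∂(M.P k s)) n h x := by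
  have hρ (k : ℕ) : BddMeas fun s => g k s - ∫ x', v (k + 1) x' ∂(M.P k s) :=
    (hg k).sub ((hv (k + 1)).integral_kernel' _)
  induction n generalizing h x with
  | zero => simpa only [trajSum_zero, add_zero] using hend x
  | succ n ih =>
    have hS := bddMeas_trajSum (M := M) (μ := μ) (ν := ν) hρ n (h + 1)
    have hx : Measurable fun c : A × B => (x, c) := measurable_prodMk_left
    rw [trajSum_succ hρ]
    refine (hle h x).trans (integral_mono (((hg h).comp hx).integrable _)
      ((((hρ h).add (hS.integral_kernel' (M.P h))).comp hx).integrable _) fun c => ?_)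
    have next_le := integral_mono ((hv (h + 1)).integrable (M.P h (x, c))) (hS.integrable _)
      (ih (h + 1) fun x => (congrArg (v · x) (Nat.add_right_comm h 1 n)).trans_le (hend x))
    dsimp only
    linarith

lemma trajSum_le {v : ℕ → X → ℝ} {g : ℕ → X × A × B → ℝ} (hv : ∀ k, BddMeas (v k))
    (hg : ∀ k, BddMeas (g k)) (hle : ∀ k x, ∫ c, g k (x, c) ∂(((μ k).1 ×ₖ (ν k).1) x) ≤ v k x)
    (n h : ℕ) (hend : ∀ x, 0 ≤ v (h + n) x) (x : X) :
    trajSum M μ ν (fun k s => g k s - ∫ x', v (k + 1) x' ∂(M.P k s)) n h x ≤ v h x := by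
  have := le_trajSum (M := M) (fun k => (hv k).neg) (fun k => (hg k).neg)
    (fun k x => by simpa only [integral_neg, neg_le_neg_iff] using hle k x) n h
    (fun x => neg_nonpos.2 (hend x)) x
  simp only [integral_neg, neg_sub_neg] at this
  rw [← neg_le_neg_iff, ← trajSum_neg]
  simpa only [neg_sub] using this

end Trajectory

/-! ### Values of policy pairs -/

section Value

variable (M : MarkovGame X A B) (μ : Policy X A) (ν : Policy X B)

lemma bddMeas_r (h : ℕ) : BddMeas (M.r h) :=
  .of_mem_Icc (M.measurable_r h) fun s => ⟨M.r_nonneg h s, M.r_le_one h s⟩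

lemma value_eq_trajSum (h : ℕ) (x : X) :
    value M μ ν h x = trajSum M μ ν M.r (M.H - h) h x := rfl

lemma bddMeas_value (h : ℕ) : BddMeas (value M μ ν h) :=
  bddMeas_trajSum (bddMeas_r M) _ _

lemma value_nonneg (h : ℕ) (x : X) : 0 ≤ value M μ ν h x :=
  integral_nonneg fun _ => Finset.sum_nonneg fun _ _ => M.r_nonneg _ _

variable {M μ ν} in
lemma value_of_le {h : ℕ} (hh : M.H ≤ h) (x : X) : value M μ ν h x = 0 := by
  rw [value_eq_trajSum, Nat.sub_eq_zero_of_le hh, trajSum_zero]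

lemma bddMeas_qValue (h : ℕ) : BddMeas (qValue M μ ν h) :=
  (bddMeas_r M h).add ((bddMeas_value M μ ν (h + 1)).integral_kernel' _)

lemma qValue_nonneg (h : ℕ) (s : X × A × B) : 0 ≤ qValue M μ ν h s :=
  add_nonneg (M.r_nonneg _ _) (integral_nonneg fun _ => value_nonneg _ _ _ _ _)

variable {M} in
lemma value_eq_integral_qValue {h : ℕ} (hh : h < M.H) (x : X) :
    value M μ ν h x = ∫ c, qValue M μ ν h (x, c) ∂(((μ h).1 ×ₖ (ν h).1) x) := by
  rw [value_eq_trajSum, show M.H - h = (M.H - (h + 1)) + 1 by omega, trajSum_succ (bddMeas_r M)]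
  rfl

variable {M μ ν} in
lemma value_congr {μ' : Policy X A} {ν' : Policy X B} (h : ℕ)
    (hμ : ∀ k, h ≤ k → μ k = μ' k) (hν : ∀ k, h ≤ k → ν k = ν' k) :
    value M μ ν h = value M μ' ν' h := by
  ext x
  simp only [value, traj_congr (M.H - h) h hμ hν]

variable {M} in
lemma value_update {h : ℕ} (hh : h < M.H) (κ : MKernel X A) (κ' : MKernel X B) (x : X) :
    value M (Function.update μ h κ) (Function.update ν h κ') h x =
      ∫ c, qValue M μ ν h (x, c) ∂((κ.1 ×ₖ κ'.1) x) := by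
  have next_eq : value M (Function.update μ h κ) (Function.update ν h κ') (h + 1) =
      value M μ ν (h + 1) :=
    value_congr (h + 1) (fun k hk => Function.update_of_ne (by omega) _ _)
      fun k hk => Function.update_of_ne (by omega) _ _
  rw [value_eq_integral_qValue _ _ hh]
  simp only [qValue, Function.update_self, next_eq]

lemma brQValue_le (h : ℕ) (s : X × A × B) : brQValue M μ h s ≤ qValue M μ ν h s :=
  ciInf_le (f := fun ν => qValue M μ ν h s) ⟨0, by rintro _ ⟨ν', rfl⟩; exact qValue_nonneg ..⟩ ν

lemma brValue_le (h : ℕ) (x : X) : brValue M μ h x ≤ value M μ ν h x :=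
  ciInf_le (f := fun ν => value M μ ν h x) ⟨0, by rintro _ ⟨ν', rfl⟩; exact value_nonneg ..⟩ ν

lemma brValue_nonneg (h : ℕ) (x : X) : 0 ≤ brValue M μ h x :=
  Real.iInf_nonneg fun _ => value_nonneg ..

/-- `ν` is a best response to `μ` from step `h` on: it attains `V_h^{μ,†}` in every state. -/
def IsBestResponse (h : ℕ) : Prop :=
  ∀ (ν' : Policy X B) (x : X), value M μ ν h x ≤ value M μ ν' h x

namespace IsBestResponse

variable {M μ ν} {h : ℕ}

lemma brValue_eq (hν : IsBestResponse M μ ν h) : brValue M μ h = value M μ ν h := by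
  have : Nonempty (Policy X B) := ⟨ν⟩
  ext x
  exact le_antisymm (brValue_le ..) (le_ciInf fun ν' => hν ν' x)

lemma brQValue_eq (hν : IsBestResponse M μ ν (h + 1)) : brQValue M μ h = qValue M μ ν h := by
  have : Nonempty (Policy X B) := ⟨ν⟩
  ext s
  refine le_antisymm (brQValue_le ..) (le_ciInf fun ν' => ?_)
  exact add_le_add le_rfl (integral_mono ((bddMeas_value ..).integrable _)
    ((bddMeas_value ..).integrable _) (hν ν'))

end IsBestResponse

end Value

/-! ### Matrix games -/

section MatrixGame

variable {G : A → B → ℝ} {p : Measure A} {q : Measure B}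

lemma payoff_eq_integral_prod {φ : X × A × B → ℝ} (hφ : BddMeas φ) (κ : Kernel X A)
    (κ' : Kernel X B) [IsMarkovKernel κ] [IsMarkovKernel κ'] (x : X) :
    payoff (fun a b => φ (x, a, b)) (κ x) (κ' x) = ∫ c, φ (x, c) ∂((κ ×ₖ κ') x) := by
  rw [Kernel.prod_apply, integral_prod _ ((hφ.comp measurable_prodMk_left).integrable _)]
  rfl

lemma payoff_zero : payoff (fun (_ : A) (_ : B) => 0) p q = 0 := by
  simp only [payoff, integral_zero]

lemma minPayoff_zero : minPayoff (fun (_ : A) (_ : B) => 0) p = 0 := by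
  simp only [minPayoff, payoff_zero, Real.iInf_const_zero]

lemma minPayoff_le (hG : ∀ a b, 0 ≤ G a b) [IsProbabilityMeasure q] :
    minPayoff G p ≤ payoff G p q :=
  ciInf_le (f := fun q : ProbabilityMeasure B => payoff G p q)
    ⟨0, by
      rintro _ ⟨q, rfl⟩
      exact integral_nonneg fun a => integral_nonneg fun b => hG a b⟩ ⟨q, inferInstance⟩

lemma IsBestReply.minPayoff_eq (hq : IsBestReply G p q) (hG : ∀ a b, 0 ≤ G a b)
    [IsProbabilityMeasure q] : minPayoff G p = payoff G p q := by
  have : Nonempty (ProbabilityMeasure B) := ⟨⟨q, inferInstance⟩⟩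
  exact le_antisymm (minPayoff_le hG) (le_ciInf hq)

lemma IsMaximin.gameValue_eq (hp : IsMaximin G p) [IsProbabilityMeasure p] :
    gameValue G = minPayoff G p := by
  have : Nonempty (ProbabilityMeasure A) := ⟨⟨p, inferInstance⟩⟩
  have bdd : BddAbove (Set.range fun p : ProbabilityMeasure A => minPayoff G (p : Measure A)) :=
    ⟨minPayoff G p, by rintro _ ⟨p', rfl⟩; exact hp p'⟩
  exact le_antisymm (ciSup_le hp) (le_ciSup bdd ⟨p, inferInstance⟩)

end MatrixGame

variable {M : MarkovGame X A B} {F : FunClass M} {σ : Selector X A B}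

/-! ### Function classes -/

/-- The standing assumptions on a function class and a tie-breaking rule. -/
structure Regular (F : FunClass M) (σ : Selector X A B) : Prop where
  isOptimal : σ.IsOptimal F
  measurable : ∀ h : Fin M.H, ∀ φ ∈ F h, Measurable φ
  boundedBy : BoundedBy F 2

/-- The factor `F_h`, extended by `{0}` past the last step to match the convention
`f^{H+1} = 0`. -/
noncomputable def stepClass (F : FunClass M) (h : ℕ) : Finset (X × A × B → ℝ) :=
  if hh : h < M.H then F ⟨h, hh⟩ else {0}

lemma stepClass_fin (F : FunClass M) (h : Fin M.H) : stepClass F h = F h :=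
  dif_pos h.2

lemma stepClass_of_le (F : FunClass M) {h : ℕ} (hh : M.H ≤ h) : stepClass F h = {0} :=
  dif_neg (not_lt.2 hh)

lemma comp_fin (f : Mem F) (h : Fin M.H) : f.comp h = (f h).1 :=
  dif_pos h.2

lemma comp_mem_stepClass (f : Mem F) (h : ℕ) : f.comp h ∈ stepClass F h := by
  unfold stepClass Mem.comp
  split_ifs with hh
  · exact (f ⟨h, hh⟩).2
  · exact Finset.mem_singleton_self _

/-- `min_q μ_h(x)^⊤ ψ(x,·,·) q` for the strategy `μ_h` that is induced by `χ`. By the tie-breaking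
rule, `V^{μ_f}_{g,h}` is this function of the components `χ = f^h` and `ψ = g^h`. -/
noncomputable def Selector.brVal (σ : Selector X A B) (h : ℕ) (χ ψ : X × A × B → ℝ) (x : X) : ℝ :=
  minPayoff (fun a b => ψ (x, a, b)) ((σ.max h χ).1 x)

lemma inducedBrValue_maxPolicy (f g : Mem F) (h : ℕ) :
    inducedBrValue (σ.maxPolicy f) g h = σ.brVal h (f.comp h) (g.comp h) := rfl

/-- Candidate value functions at step `h`. -/
structure IsStepValue (M : MarkovGame X A B) (h : ℕ) (v : X → ℝ) : Prop where
  measurable : Measurable v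
  mem_Icc : ∀ x, v x ∈ Set.Icc (0 : ℝ) 1
  eq_zero : M.H ≤ h → ∀ x, v x = 0

lemma IsStepValue.bddMeas {h : ℕ} {v : X → ℝ} (hv : IsStepValue M h v) : BddMeas v :=
  .of_mem_Icc hv.measurable hv.mem_Icc

namespace Regular

variable (R : Regular F σ) {h : ℕ} {φ χ ψ : X × A × B → ℝ} (f g : Mem F)

include R

lemma measurable_of_mem (hφ : φ ∈ stepClass F h) : Measurable φ := by
  unfold stepClass at hφ
  split_ifs at hφ with hh
  · exact R.measurable _ _ hφ
  · exact Finset.mem_singleton.1 hφ ▸ measurable_const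

lemma mem_Icc_of_mem (hφ : φ ∈ stepClass F h) (s : X × A × B) : φ s ∈ Set.Icc (0 : ℝ) 1 := by
  unfold stepClass at hφ
  split_ifs at hφ with hh
  · exact ⟨(R.boundedBy _ _ hφ s).1, (R.boundedBy _ _ hφ s).2.trans (by norm_num)⟩
  · simp only [Finset.mem_singleton.1 hφ, Pi.zero_apply, Set.left_mem_Icc, zero_le_one]

lemma bddMeas_of_mem (hφ : φ ∈ stepClass F h) : BddMeas φ :=
  .of_mem_Icc (R.measurable_of_mem hφ) (R.mem_Icc_of_mem hφ)

lemma bddMeas_comp (k : ℕ) : BddMeas (f.comp k) :=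
  R.bddMeas_of_mem (comp_mem_stepClass f k)

lemma isMaximin (hφ : φ ∈ stepClass F h) (x : X) :
    IsMaximin (fun a b => φ (x, a, b)) ((σ.max h φ).1 x) := by
  unfold stepClass at hφ
  split_ifs at hφ with hh
  · exact R.isOptimal.max_isMaximin ⟨h, hh⟩ φ hφ x
  · intro p'
    simp only [Finset.mem_singleton.1 hφ, Pi.zero_apply, minPayoff_zero, le_refl]

lemma isBestReply (hχ : χ ∈ stepClass F h) (hψ : ψ ∈ stepClass F h) (x : X) :
    IsBestReply (fun a b => ψ (x, a, b)) ((σ.max h χ).1 x) ((σ.min h χ ψ).1 x) := by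
  unfold stepClass at hχ hψ
  split_ifs at hχ hψ with hh
  · exact R.isOptimal.min_isBestReply ⟨h, hh⟩ χ hχ ψ hψ x
  · intro q'
    simp only [Finset.mem_singleton.1 hψ, Pi.zero_apply, payoff_zero, le_refl]

lemma brVal_eq_integral (hχ : χ ∈ stepClass F h) (hψ : ψ ∈ stepClass F h) (x : X) :
    σ.brVal h χ ψ x = ∫ c, ψ (x, c) ∂(((σ.max h χ).1 ×ₖ (σ.min h χ ψ).1) x) :=
  ((R.isBestReply hχ hψ x).minPayoff_eq fun _ _ => (R.mem_Icc_of_mem hψ _).1).trans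
    (payoff_eq_integral_prod (R.bddMeas_of_mem hψ) _ _ x)

lemma brVal_le_integral (hψ : ψ ∈ stepClass F h) (κ : MKernel X B) (x : X) :
    σ.brVal h χ ψ x ≤ ∫ c, ψ (x, c) ∂(((σ.max h χ).1 ×ₖ κ.1) x) :=
  (minPayoff_le fun _ _ => (R.mem_Icc_of_mem hψ _).1).trans_eq
    (payoff_eq_integral_prod (R.bddMeas_of_mem hψ) _ _ x)

lemma isStepValue_brVal (hχ : χ ∈ stepClass F h) (hψ : ψ ∈ stepClass F h) :
    IsStepValue M h (σ.brVal h χ ψ) where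
  measurable := by
    rw [funext (R.brVal_eq_integral hχ hψ)]
    exact ((R.bddMeas_of_mem hψ).integral_kernel _).measurable
  mem_Icc x := by
    rw [R.brVal_eq_integral hχ hψ]
    exact integral_mem_Icc_of_forall
      ((R.measurable_of_mem hψ).comp measurable_prodMk_left) fun c => R.mem_Icc_of_mem hψ (x, c)
  eq_zero hh x := by
    rw [stepClass_of_le F hh, Finset.mem_singleton] at hψ
    simp only [Selector.brVal, hψ, Pi.zero_apply, minPayoff_zero]

lemma isStepValue_inducedBrValue (k : ℕ) :
    IsStepValue M k (inducedBrValue (σ.maxPolicy f) g k) :=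
  R.isStepValue_brVal (comp_mem_stepClass f k) (comp_mem_stepClass g k)

lemma inducedValue_eq : inducedValue f = inducedBrValue (σ.maxPolicy f) f := by
  ext k x
  exact (R.isMaximin (comp_mem_stepClass f k) x).gameValue_eq

lemma bddMeas_bellman (k : ℕ) : BddMeas (bellman (σ.maxPolicy f) g k) :=
  (bddMeas_r M k).add ((R.isStepValue_inducedBrValue f g (k + 1)).bddMeas.integral_kernel' _)

lemma bddMeas_residual (k : ℕ) : BddMeas (residual (σ.maxPolicy f) g k) :=
  (R.bddMeas_comp g k).sub (R.bddMeas_bellman f g k)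

/-! ### Value decomposition -/

lemma trajSum_residual_add_value (ν : Policy X B) :
    trajSum M (σ.maxPolicy f) ν (fun k s => g.comp k s -
      ∫ x', inducedBrValue (σ.maxPolicy f) g (k + 1) x' ∂(M.P k s)) M.H 0 M.x₁ =
    ∑ h : Fin M.H, ∫ ζ, residual (σ.maxPolicy f) g h (ζ h) ∂(episodeLaw M (σ.maxPolicy f) ν) +
      value M (σ.maxPolicy f) ν 0 M.x₁ := by
  rw [value_eq_trajSum, Nat.sub_zero, ← trajSum_episode (R.bddMeas_residual f g),
    ← trajSum_add (R.bddMeas_residual f g) (bddMeas_r M)]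
  congr! 3 with k s
  simp only [residual, bellman]
  ring

lemma inducedBrValue_sub_value_le (ν : Policy X B) :
    inducedBrValue (σ.maxPolicy f) g 0 M.x₁ - value M (σ.maxPolicy f) ν 0 M.x₁ ≤
      ∑ h : Fin M.H, ∫ ζ, residual (σ.maxPolicy f) g h (ζ h)
        ∂(episodeLaw M (σ.maxPolicy f) ν) := by
  rw [sub_le_iff_le_add, ← R.trajSum_residual_add_value]
  exact le_trajSum (fun k => (R.isStepValue_inducedBrValue f g k).bddMeas) (R.bddMeas_comp g)
    (fun k x => R.brVal_le_integral (comp_mem_stepClass g k) (ν k) x) M.H 0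
    (fun x => ((R.isStepValue_inducedBrValue f g _).eq_zero (by omega) x).le) M.x₁

lemma inducedBrValue_sub_value_minPolicy :
    inducedBrValue (σ.maxPolicy f) g 0 M.x₁ -
        value M (σ.maxPolicy f) (σ.minPolicy f g) 0 M.x₁ =
      ∑ h : Fin M.H, ∫ ζ, residual (σ.maxPolicy f) g h (ζ h)
        ∂(episodeLaw M (σ.maxPolicy f) (σ.minPolicy f g)) := by
  refine (R.inducedBrValue_sub_value_le f g _).antisymm ?_
  rw [le_sub_iff_add_le, ← R.trajSum_residual_add_value]
  exact trajSum_le (fun k => (R.isStepValue_inducedBrValue f g k).bddMeas) (R.bddMeas_comp g)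
    (fun k x => (R.brVal_eq_integral (comp_mem_stepClass f k) (comp_mem_stepClass g k) x).ge)
    M.H 0 (fun x => ((R.isStepValue_inducedBrValue f g _).eq_zero (by omega) x).ge) M.x₁

end Regular

/-! ### Comparators -/

/-- `g` solves the Bellman equations `g^h = 𝒯_h^μ g`. The posteriors are compared with the
point masses at such elements of `F`. -/
def IsBellmanFixedPoint (μ : Policy X A) (g : Mem F) : Prop :=
  ∀ h : Fin M.H, g.comp h = bellman μ g h

namespace Regular

variable (R : Regular F σ)

include R

lemma inducedBrValue_le_value {f g : Mem F} {ν : Policy X B} {h : ℕ} (hh : h < M.H)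
    (hg : ∀ s, g.comp h s ≤ qValue M (σ.maxPolicy f) ν h s) (x : X) :
    inducedBrValue (σ.maxPolicy f) g h x ≤ value M (σ.maxPolicy f) ν h x := by
  rw [value_eq_integral_qValue _ _ hh]
  refine (R.brVal_le_integral (comp_mem_stepClass g h) (ν h) x).trans
    (integral_mono (((R.bddMeas_comp g h).comp measurable_prodMk_left).integrable _)
      (((bddMeas_qValue ..).comp measurable_prodMk_left).integrable _) fun c => hg (x, c))

lemma inducedBrValue_eq_value {f g : Mem F} {h : ℕ} (hh : h < M.H)
    (hg : g.comp h = qValue M (σ.maxPolicy f) (σ.minPolicy f g) h) :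
    inducedBrValue (σ.maxPolicy f) g h = value M (σ.maxPolicy f) (σ.minPolicy f g) h := by
  ext x
  rw [value_eq_integral_qValue _ _ hh, ← hg]
  exact R.brVal_eq_integral (comp_mem_stepClass f h) (comp_mem_stepClass g h) x

section BestResponse

variable {f g : Mem F} (hg : ∀ h : Fin M.H, g.comp h = brQValue M (σ.maxPolicy f) h)

include hg

lemma isBestResponse_minPolicy {h : ℕ} (hh : h ≤ M.H) :
    IsBestResponse M (σ.maxPolicy f) (σ.minPolicy f g) h := by
  induction hh using Nat.decreasingInduction with
  | self => exact fun ν' x => by rw [value_of_le le_rfl, value_of_le le_rfl]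
  | of_succ h hh next =>
    intro ν' x
    rw [← R.inducedBrValue_eq_value hh ((hg ⟨h, hh⟩).trans next.brQValue_eq)]
    exact R.inducedBrValue_le_value hh
      (fun s => (congrFun (hg ⟨h, hh⟩) s).trans_le (brQValue_le ..)) x

lemma inducedBrValue_eq_value_minPolicy (h : ℕ) :
    inducedBrValue (σ.maxPolicy f) g h = value M (σ.maxPolicy f) (σ.minPolicy f g) h := by
  rcases lt_or_ge h M.H with hh | hh
  · exact R.inducedBrValue_eq_value hh
      ((hg ⟨h, hh⟩).trans (R.isBestResponse_minPolicy hg hh).brQValue_eq)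
  · ext x
    rw [value_of_le hh, (R.isStepValue_inducedBrValue f g h).eq_zero hh]

lemma inducedBrValue_eq_brValue :
    inducedBrValue (σ.maxPolicy f) g 0 = brValue M (σ.maxPolicy f) 0 := by
  rw [(R.isBestResponse_minPolicy hg (Nat.zero_le _)).brValue_eq,
    R.inducedBrValue_eq_value_minPolicy hg]

lemma isBellmanFixedPoint_of_eq_brQValue : IsBellmanFixedPoint (σ.maxPolicy f) g := by
  intro h
  ext s
  rw [hg, (R.isBestResponse_minPolicy hg h.2).brQValue_eq, bellman,
    R.inducedBrValue_eq_value_minPolicy hg, qValue]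

end BestResponse

section Nash

variable {μs : Policy X A} {νs : Policy X B} (hN : IsNash M μs νs) {f : Mem F}
  (hf : ∀ h : Fin M.H, f.comp h = qValue M μs νs h)

include hN hf

lemma inducedBrValue_le_nashValue {h : ℕ} (hh : h < M.H) (x : X) :
    inducedBrValue (σ.maxPolicy f) f h x ≤ value M μs νs h x := by
  refine (R.brVal_le_integral (comp_mem_stepClass f h) (νs h) x).trans ?_
  rw [hf ⟨h, hh⟩, ← value_update _ _ hh, Function.update_eq_self]
  exact (hN h hh x).1 _

lemma nashValue_le_inducedBrValue {h : ℕ} (hh : h < M.H) (x : X) :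
    value M μs νs h x ≤ inducedBrValue (σ.maxPolicy f) f h x := by
  have : Nonempty (ProbabilityMeasure B) := ⟨⟨(νs h).1 x, inferInstance⟩⟩
  have hm := comp_mem_stepClass f h
  refine le_trans (le_ciInf fun q => ?_) (R.isMaximin hm x ⟨(μs h).1 x, inferInstance⟩)
  let κ : MKernel X B := ⟨Kernel.const X (q : Measure B), inferInstance⟩
  refine ((hN h hh x).2 (Function.update νs h κ)).trans_eq ?_
  rw [← Function.update_eq_self h μs, value_update _ _ hh, Function.update_eq_self, ← hf ⟨h, hh⟩,
    ← payoff_eq_integral_prod (R.bddMeas_comp f h)]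
  rfl

lemma inducedBrValue_eq_nashValue (h : ℕ) :
    inducedBrValue (σ.maxPolicy f) f h = value M μs νs h := by
  ext x
  rcases lt_or_ge h M.H with hh | hh
  · exact (R.inducedBrValue_le_nashValue hN hf hh x).antisymm
      (R.nashValue_le_inducedBrValue hN hf hh x)
  · rw [value_of_le hh, (R.isStepValue_inducedBrValue f f h).eq_zero hh]

lemma isBellmanFixedPoint_of_eq_nashQValue : IsBellmanFixedPoint (σ.maxPolicy f) f := by
  intro h
  ext s
  rw [hf, bellman, R.inducedBrValue_eq_nashValue hN hf, qValue]

end Nash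

lemma exists_isBellmanFixedPoint_brValue (f : Mem F)
    (hF : ∀ h : Fin M.H, brQValue M (σ.maxPolicy f) h ∈ F h) :
    ∃ g : Mem F, IsBellmanFixedPoint (σ.maxPolicy f) g ∧
      inducedBrValue (σ.maxPolicy f) g 0 = brValue M (σ.maxPolicy f) 0 := by
  let g : Mem F := fun h => ⟨_, hF h⟩
  exact ⟨g, R.isBellmanFixedPoint_of_eq_brQValue (comp_fin g),
    R.inducedBrValue_eq_brValue (comp_fin g)⟩

lemma exists_isBellmanFixedPoint_nashValue {μs : Policy X A} {νs : Policy X B}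
    (hN : IsNash M μs νs) (hF : ∀ h : Fin M.H, qValue M μs νs h ∈ F h) :
    ∃ f : Mem F, IsBellmanFixedPoint (σ.maxPolicy f) f ∧
      inducedBrValue (σ.maxPolicy f) f 0 = value M μs νs 0 := by
  let f : Mem F := fun h => ⟨_, hF h⟩
  exact ⟨f, R.isBellmanFixedPoint_of_eq_nashQValue hN (comp_fin f),
    R.inducedBrValue_eq_nashValue hN (comp_fin f) 0⟩

end Regular

/-! ### Excess losses -/

/-- The regression target `r^h + 𝔼 v` of the squared loss at step `h` for the next-step value
function `v`. -/
noncomputable def target (M : MarkovGame X A B) (h : ℕ) (v : X → ℝ) (s : X × A × B) : ℝ :=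
  M.r h s + ∫ x', v x' ∂(M.P h s)

/-- The observed next-step value `v(x^{h+1})`, which is `0` after the last step. -/
noncomputable def nextValue (h : Fin M.H) (v : X → ℝ) (ζ : Trajectory M) : ℝ :=
  if hh : (h : ℕ) + 1 < M.H then v (ζ ⟨h + 1, hh⟩).1 else 0

/-- The squared loss of `φ` in one episode in excess of that of the regression target. -/
noncomputable def excessLoss (h : Fin M.H) (v : X → ℝ) (φ : X × A × B → ℝ)
    (ζ : Trajectory M) : ℝ :=
  (φ (ζ h) - M.r h (ζ h) - nextValue h v ζ) ^ 2 -
    (target M h v (ζ h) - M.r h (ζ h) - nextValue h v ζ) ^ 2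

/-- The mean squared deviation of `φ` from the regression target. -/
noncomputable def meanSqDev (h : Fin M.H) (v : X → ℝ) (φ : X × A × B → ℝ)
    (μ : Policy X A) (ν : Policy X B) : ℝ :=
  ∫ ζ, (φ (ζ h) - target M h v (ζ h)) ^ 2 ∂(episodeLaw M μ ν)

lemma meanSqDev_nonneg (h : Fin M.H) (v : X → ℝ) (φ : X × A × B → ℝ)
    (μ : Policy X A) (ν : Policy X B) : 0 ≤ meanSqDev h v φ μ ν :=
  integral_nonneg fun _ => sq_nonneg _

namespace IsStepValue

variable {h : Fin M.H} {v : X → ℝ} {φ : X × A × B → ℝ} (hv : IsStepValue M (h + 1) v)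
  (hφ : Measurable φ) (h01 : ∀ s, φ s ∈ Set.Icc (0 : ℝ) 1)

include hv

lemma bddMeas_target : BddMeas (target M h v) :=
  (bddMeas_r M h).add (hv.bddMeas.integral_kernel' _)

lemma bddMeas_nextValue : BddMeas (nextValue h v) := by
  unfold nextValue
  split_ifs with hh
  · exact hv.bddMeas.comp (measurable_fst.comp (measurable_pi_apply _))
  · exact .const 0

include h01 in
lemma abs_sub_target_le (s : X × A × B) : |φ s - target M h v s| ≤ 2 := by
  have hmean : ∫ x', v x' ∂(M.P h s) ∈ Set.Icc (0 : ℝ) 1 :=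
    integral_mem_Icc_of_forall hv.measurable hv.mem_Icc
  unfold target
  rw [abs_le]
  constructor <;>
    linarith [(h01 s).1, (h01 s).2, hmean.1, hmean.2, M.r_nonneg h s, M.r_le_one h s]

include hφ h01

lemma bddMeas_excessLoss : BddMeas (excessLoss h v φ) :=
  have heval : Measurable fun ζ : Trajectory M => ζ h := measurable_pi_apply h
  have hr := (bddMeas_r M h).comp heval
  (((((BddMeas.of_mem_Icc hφ h01).comp heval).sub hr).sub hv.bddMeas_nextValue).pow 2).sub
    ((((hv.bddMeas_target.comp heval).sub hr).sub hv.bddMeas_nextValue).pow 2)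

lemma integral_exp_excessLoss_eq (η : ℝ) (μ : Policy X A) (ν : Policy X B) :
    ∫ ζ, Real.exp (-η * excessLoss h v φ ζ) ∂(episodeLaw M μ ν) =
      ∫ ζ, ∫ x', Real.exp (-η * ((φ (ζ h) - M.r h (ζ h) - v x') ^ 2 -
        (target M h v (ζ h) - M.r h (ζ h) - v x') ^ 2)) ∂(M.P h (ζ h)) ∂(episodeLaw M μ ν) := by
  by_cases hh : (h : ℕ) + 1 < M.H
  · have hφr : BddMeas fun s => φ s - M.r h s := (BddMeas.of_mem_Icc hφ h01).sub (bddMeas_r M h)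
    have htr := hv.bddMeas_target.sub (bddMeas_r M h)
    have hG : BddMeas fun p : (X × A × B) × X => Real.exp (-η *
        ((φ p.1 - M.r h p.1 - v p.2) ^ 2 - (target M h v p.1 - M.r h p.1 - v p.2) ^ 2)) :=
      (((((hφr.comp measurable_fst).sub (hv.bddMeas.comp measurable_snd)).pow 2).sub
        (((htr.comp measurable_fst).sub (hv.bddMeas.comp measurable_snd)).pow 2)).const_mul _).exp
    simpa only [excessLoss, nextValue, hh, dif_pos, zero_add, Fin.eta, episodeLaw] using
      integral_traj_next_state M μ ν M.H 0 M.x₁ h hh hG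
  · simp only [excessLoss, nextValue, hh, dif_neg, not_false_iff, hv.eq_zero (not_lt.1 hh),
      integral_const, probReal_univ, one_smul]

lemma integral_exp_excessLoss_le {η : ℝ} (h0 : 0 ≤ η) (h5 : η ≤ 1 / 5) (μ : Policy X A)
    (ν : Policy X B) :
    ∫ ζ, Real.exp (-η * excessLoss h v φ ζ) ∂(episodeLaw M μ ν) ≤
      Real.exp (-(η / 2) * meanSqDev h v φ μ ν) := by
  have heval : Measurable fun ζ : Trajectory M => ζ h := measurable_pi_apply h
  have hdev : BddMeas fun s => φ s - target M h v s :=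
    (BddMeas.of_mem_Icc hφ h01).sub hv.bddMeas_target
  set c := η - η ^ 2 / 2 with hc
  have rate : η / 2 ≤ c * (1 - 2 * c) := by nlinarith [mul_nonneg h0 (sub_nonneg.2 h5)]
  have conditional (s : X × A × B) :
      ∫ x', Real.exp (-η * ((φ s - M.r h s - v x') ^ 2 -
        (target M h v s - M.r h s - v x') ^ 2)) ∂(M.P h s) ≤
      Real.exp (-c * (φ s - target M h v s) ^ 2) := by
    refine le_of_eq_of_le ?_ (integral_exp_sq_sub_sq_le (M.P h s) hv.measurable hv.mem_Icc η
      (φ s - target M h v s))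
    congr! 2 with x'
    simp only [target]
    ring_nf
  calc ∫ ζ, Real.exp (-η * excessLoss h v φ ζ) ∂(episodeLaw M μ ν)
      ≤ ∫ ζ, Real.exp (-c * (φ (ζ h) - target M h v (ζ h)) ^ 2) ∂(episodeLaw M μ ν) := by
        rw [hv.integral_exp_excessLoss_eq hφ h01]
        exact integral_mono_of_nonneg
          (ae_of_all _ fun ζ => integral_nonneg fun _ => (Real.exp_pos _).le)
          ((((hdev.comp heval).pow 2).const_mul _).exp.integrable _)
          (ae_of_all _ fun ζ => conditional (ζ h))
    _ ≤ Real.exp (-(c * (1 - 2 * c)) * meanSqDev h v φ μ ν) :=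
        integral_exp_neg_mul_sq_le _ (hdev.measurable.comp heval)
          (fun ζ => hv.abs_sub_target_le h01 (ζ h)) (by nlinarith)
    _ ≤ Real.exp (-(η / 2) * meanSqDev h v φ μ ν) :=
        Real.exp_le_exp.2 (mul_le_mul_of_nonneg_right (neg_le_neg rate) (meanSqDev_nonneg ..))

end IsStepValue

instance : DiscreteMeasurableSpace (Mem F) := ⟨fun _ => trivial⟩

/-! ### The posteriors -/

section Loss

variable (v : ℕ → X → ℝ) (h : Fin M.H) (φ : X × A × B → ℝ) {t : ℕ} (S : Fin t → Trajectory M)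

lemma loss_eq :
    loss M v h φ S =
      ∑ s, (φ (S s h) - M.r h (S s h) - nextValue h (v (h + 1)) (S s)) ^ 2 :=
  dif_pos h.2

lemma loss_sub_loss_target :
    loss M v h φ S - loss M v h (target M h (v (h + 1))) S =
      ∑ s, excessLoss h (v (h + 1)) φ (S s) := by
  rw [loss_eq, loss_eq, ← Finset.sum_sub_distrib]
  rfl

end Loss

lemma measurable_loss {v : ℕ → X → ℝ} (hv : ∀ h, IsStepValue M h (v h)) (h : Fin M.H)
    {φ : X × A × B → ℝ} (hφ : Measurable φ) (t : ℕ) :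
    Measurable fun S : Fin t → Trajectory M => loss M v h φ S := by
  simp only [loss_eq]
  refine Finset.measurable_fun_sum _ fun s _ => Measurable.pow_const ?_ 2
  have heval : Measurable fun S : Fin t → Trajectory M => S s h := by fun_prop
  exact ((hφ.comp heval).sub ((M.measurable_r h).comp heval)).sub
    ((hv (h + 1)).bddMeas_nextValue.measurable.comp (measurable_pi_apply s))

lemma card_factor_pos (f : Mem F) (h : Fin M.H) : (0 : ℝ) < (F h).card :=
  Nat.cast_pos.2 (Finset.card_pos.2 ⟨_, (f h).2⟩)

section CondProd

variable (η l : ℝ) (v : ℕ → X → ℝ) (f : Mem F) {t : ℕ} (S : Fin t → Trajectory M)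

lemma condProd_pos : 0 < condProd η v f S := by
  refine Finset.prod_pos fun h _ => ?_
  have := card_factor_pos f h
  exact div_pos (by positivity) (Finset.sum_pos (fun _ _ => by positivity) ⟨_, (f h).2⟩)

lemma neg_log_condProd :
    -Real.log (condProd η v f S) = ∑ h : Fin M.H, Real.log (∑ φ ∈ F h,
      Real.exp (-η * (loss M v h φ S - loss M v h (f.comp h) S))) := by
  have normalizer_pos (h : Fin M.H) : 0 < ∑ φ ∈ F h, 1 / ((F h).card : ℝ) *
      Real.exp (-η * loss M v h φ S) := by
    have := card_factor_pos f h
    exact Finset.sum_pos (fun _ _ => by positivity) ⟨_, (f h).2⟩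
  rw [condProd, Real.log_prod fun h _ => ?_, ← Finset.sum_neg_distrib]
  · refine Finset.sum_congr rfl fun h _ => ?_
    have := card_factor_pos f h
    rw [← Real.log_inv, inv_div, Finset.sum_div]
    congr! 2 with φ
    rw [mul_div_mul_left _ _ (by positivity), ← Real.exp_sub]
    ring_nf
  · have := card_factor_pos f h
    have := normalizer_pos h
    positivity

lemma mainWeight_pos : 0 < mainWeight η l S f :=
  mul_pos (Real.exp_pos _) (condProd_pos ..)

lemma boosterWeight_pos (μ : Policy X A) : 0 < boosterWeight η l μ S f :=
  mul_pos (Real.exp_pos _) (condProd_pos ..)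

lemma mainPosterior_eq_normalize :
    mainPosterior η l S f = normalize (mainWeight η l S) f := rfl

lemma boosterPosterior_eq_normalize (μ : Policy X A) :
    boosterPosterior η l μ S f = normalize (boosterWeight η l μ S) f := rfl

end CondProd

namespace Regular

variable (R : Regular F σ) (η l : ℝ) (f g : Mem F) (t : ℕ)

include R

lemma measurable_condProd {v : ℕ → X → ℝ} (hv : ∀ h, IsStepValue M h (v h)) :
    Measurable fun S : Fin t → Trajectory M => condProd η v f S := by
  have hexp (h : Fin M.H) {φ : X × A × B → ℝ} (hφ : φ ∈ F h) :
      Measurable fun S : Fin t → Trajectory M =>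
        1 / ((F h).card : ℝ) * Real.exp (-η * loss M v h φ S) :=
    (((measurable_loss hv h (R.measurable h φ hφ) t).const_mul _).exp).const_mul _
  refine Finset.measurable_fun_prod _ fun h _ => Measurable.div ?_
    (Finset.measurable_fun_sum _ fun φ hφ => hexp h hφ)
  exact hexp h (comp_fin f h ▸ (f h).2)

lemma bddMeas_mainPosterior :
    BddMeas fun S : Fin t → Trajectory M => mainPosterior η l S f := by
  refine bddMeas_normalize (fun S f => mainWeight_pos η l f S) (fun f => ?_) f
  simp only [mainWeight, R.inducedValue_eq]
  exact (R.measurable_condProd η f t (R.isStepValue_inducedBrValue f f)).const_mul _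

lemma bddMeas_boosterPosterior :
    BddMeas fun S : Fin t → Trajectory M => boosterPosterior η l (σ.maxPolicy f) S g :=
  bddMeas_normalize (fun S g => boosterWeight_pos η l g S _) (fun g =>
    (R.measurable_condProd η g t (R.isStepValue_inducedBrValue f g)).const_mul _) g

end Regular

/-! ### Integration along the learning process -/

/-- The conditional probability of sampling `(f, g)` after the episodes `ω`. -/
noncomputable def sampleProb (σ : Selector X A B) (η l : ℝ) {t : ℕ} (ω : Fin t → Episode F)
    (f g : Mem F) : ℝ :=
  mainPosterior η l (fun s => (ω s).2.2) f *
    boosterPosterior η l (σ.maxPolicy f) (fun s => (ω s).2.2) g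

lemma sampleProb_nonneg (η l : ℝ) {t : ℕ} (ω : Fin t → Episode F) (f g : Mem F) :
    0 ≤ sampleProb σ η l ω f g :=
  mul_nonneg (normalize_pos (fun f => mainWeight_pos η l f _) f).le
    (normalize_pos (fun g => boosterWeight_pos η l g _ _) g).le

lemma sum_sampleProb [Nonempty (Mem F)] (η l : ℝ) {t : ℕ} (ω : Fin t → Episode F) :
    ∑ f : Mem F, ∑ g : Mem F, sampleProb σ η l ω f g = 1 := by
  simp only [sampleProb, ← Finset.mul_sum, mainPosterior_eq_normalize,
    boosterPosterior_eq_normalize, sum_normalize (fun g => boosterWeight_pos η l g _ _),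
    sum_normalize (fun f => mainWeight_pos η l f _), mul_one]

lemma measurable_snoc_episode (t : ℕ) (f g : Mem F) :
    Measurable fun p : (Fin t → Episode F) × Trajectory M =>
      (Fin.snoc p.1 ((f, g, p.2) : Episode F) : Fin (t + 1) → Episode F) := by
  refine measurable_pi_iff.2 (Fin.lastCases ?_ fun j => ?_)
  · simp only [Fin.snoc_last]
    fun_prop
  · simp only [Fin.snoc_castSucc]
    fun_prop

lemma processLaw_succ (η l : ℝ) (t : ℕ) :
    processLaw F σ η l (t + 1) = ∑ f : Mem F, ∑ g : Mem F,
      (((processLaw F σ η l t).withDensity fun ω => ENNReal.ofReal (sampleProb σ η l ω f g)).prod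
        (episodeLaw M (σ.maxPolicy f) (σ.minPolicy f g))).map
          fun p : (Fin t → Episode F) × Trajectory M =>
            (Fin.snoc p.1 ((f, g, p.2) : Episode F) : Fin (t + 1) → Episode F) :=
  rfl

lemma bddMeas_integral_snoc (t : ℕ) (f g : Mem F) {Φ : (Fin (t + 1) → Episode F) → ℝ}
    (hΦ : BddMeas Φ) :
    BddMeas fun ω : Fin t → Episode F => ∫ ζ, Φ (Fin.snoc ω ((f, g, ζ) : Episode F))
      ∂(episodeLaw M (σ.maxPolicy f) (σ.minPolicy f g)) :=
  (hΦ.comp (measurable_snoc_episode t f g)).integral_kernel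
    (Kernel.const _ (episodeLaw M (σ.maxPolicy f) (σ.minPolicy f g)))

namespace Regular

variable (R : Regular F σ) (η l : ℝ)

include R

lemma bddMeas_sampleProb (t : ℕ) (f g : Mem F) :
    BddMeas fun ω : Fin t → Episode F => sampleProb σ η l ω f g :=
  ((R.bddMeas_mainPosterior η l f t).comp (by fun_prop)).mul
    ((R.bddMeas_boosterPosterior η l f g t).comp (by fun_prop))

lemma isFiniteMeasure_withDensity_sampleProb (t : ℕ) (f g : Mem F)
    [IsFiniteMeasure (processLaw F σ η l t)] :
    IsFiniteMeasure ((processLaw F σ η l t).withDensity fun ω =>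
      ENNReal.ofReal (sampleProb σ η l ω f g)) :=
  isFiniteMeasure_withDensity_ofReal ((R.bddMeas_sampleProb η l t f g).integrable _).2

lemma isFiniteMeasure_processLaw (t : ℕ) : IsFiniteMeasure (processLaw F σ η l t) := by
  induction t with
  | zero =>
    unfold processLaw
    infer_instance
  | succ t ih =>
    have := R.isFiniteMeasure_withDensity_sampleProb η l t
    rw [processLaw_succ]
    infer_instance

lemma integral_processLaw_succ_summand (t : ℕ) (f g : Mem F)
    {Φ : (Fin (t + 1) → Episode F) → ℝ} (hΦ : BddMeas Φ) :
    ∫ ω, Φ ω ∂((((processLaw F σ η l t).withDensity fun ω =>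
        ENNReal.ofReal (sampleProb σ η l ω f g)).prod
      (episodeLaw M (σ.maxPolicy f) (σ.minPolicy f g))).map
        fun p : (Fin t → Episode F) × Trajectory M =>
          (Fin.snoc p.1 ((f, g, p.2) : Episode F) : Fin (t + 1) → Episode F)) =
      ∫ ω, sampleProb σ η l ω f g * ∫ ζ, Φ (Fin.snoc ω ((f, g, ζ) : Episode F))
        ∂(episodeLaw M (σ.maxPolicy f) (σ.minPolicy f g)) ∂(processLaw F σ η l t) := by
  have := R.isFiniteMeasure_processLaw η l t
  have := R.isFiniteMeasure_withDensity_sampleProb η l t f g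
  have hsnoc := measurable_snoc_episode t f g
  rw [integral_map hsnoc.aemeasurable hΦ.measurable.aestronglyMeasurable,
    integral_prod _ ((hΦ.comp hsnoc).integrable _),
    integral_withDensity_eq_integral_toReal_smul
      (R.bddMeas_sampleProb η l t f g).measurable.ennreal_ofReal
      (ae_of_all _ fun _ => ENNReal.ofReal_lt_top)]
  simp only [smul_eq_mul, ENNReal.toReal_ofReal (sampleProb_nonneg η l _ f g)]

lemma integral_processLaw_succ (t : ℕ) {Φ : (Fin (t + 1) → Episode F) → ℝ} (hΦ : BddMeas Φ) :
    ∫ ω, Φ ω ∂(processLaw F σ η l (t + 1)) =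
      ∫ ω, ∑ f : Mem F, ∑ g : Mem F, sampleProb σ η l ω f g *
        ∫ ζ, Φ (Fin.snoc ω ((f, g, ζ) : Episode F))
          ∂(episodeLaw M (σ.maxPolicy f) (σ.minPolicy f g)) ∂(processLaw F σ η l t) := by
  have := R.isFiniteMeasure_processLaw η l t
  have := R.isFiniteMeasure_withDensity_sampleProb η l t
  have integrable_summand (f g : Mem F) := ((R.bddMeas_sampleProb η l t f g).mul
    (bddMeas_integral_snoc (σ := σ) t f g hΦ)).integrable (processLaw F σ η l t)
  rw [processLaw_succ, integral_finsetSum_measure fun f _ => hΦ.integrable _,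
    integral_finsetSum _ fun f _ => integrable_finsetSum _ fun g _ => integrable_summand f g]
  refine Finset.sum_congr rfl fun f _ => ?_
  rw [integral_finsetSum_measure fun g _ => hΦ.integrable _,
    integral_finsetSum _ fun g _ => integrable_summand f g]
  exact Finset.sum_congr rfl fun g _ => R.integral_processLaw_succ_summand η l t f g hΦ

lemma isProbabilityMeasure_processLaw [Nonempty (Mem F)] (t : ℕ) :
    IsProbabilityMeasure (processLaw F σ η l t) := by
  induction t with
  | zero =>
    unfold processLaw
    infer_instance
  | succ t ih =>
    have := R.isFiniteMeasure_processLaw η l (t + 1)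
    have total_mass := R.integral_processLaw_succ η l t (BddMeas.const 1)
    simp only [integral_const, probReal_univ, smul_eq_mul, mul_one, sum_sampleProb] at total_mass
    exact isProbabilityMeasure_iff_real.2 total_mass

lemma integral_exp_sum_processLaw_le_one [Nonempty (Mem F)] {G : Episode F → ℝ} (hG : BddMeas G)
    (hG_exp : ∀ f g : Mem F, ∫ ζ, Real.exp (G (f, g, ζ))
      ∂(episodeLaw M (σ.maxPolicy f) (σ.minPolicy f g)) ≤ 1) (t : ℕ) :
    ∫ ω, Real.exp (∑ s, G (ω s)) ∂(processLaw F σ η l t) ≤ 1 := by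
  have hexp (t : ℕ) : BddMeas fun ω : Fin t → Episode F => Real.exp (∑ s, G (ω s)) :=
    (BddMeas.sum fun s _ => hG.comp (measurable_pi_apply s)).exp
  induction t with
  | zero =>
    have := R.isProbabilityMeasure_processLaw η l 0
    simp only [Finset.univ_eq_empty, Finset.sum_empty, Real.exp_zero, integral_const,
      probReal_univ, smul_eq_mul, mul_one, le_refl]
  | succ t ih =>
    have := R.isProbabilityMeasure_processLaw η l t
    refine le_trans ?_ ih
    rw [R.integral_processLaw_succ η l t (hexp (t + 1))]
    simp only [Fin.sum_univ_castSucc, Fin.snoc_castSucc, Fin.snoc_last, Real.exp_add,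
      integral_const_mul]
    refine integral_mono (BddMeas.integrable (BddMeas.sum fun f _ => BddMeas.sum fun g _ =>
      (R.bddMeas_sampleProb η l t f g).mul ((hexp t).mul (.const _))) _)
      ((hexp t).integrable _) fun ω => ?_
    calc ∑ f, ∑ g, sampleProb σ η l ω f g * (Real.exp (∑ s, G (ω s)) *
          ∫ ζ, Real.exp (G (f, g, ζ)) ∂(episodeLaw M (σ.maxPolicy f) (σ.minPolicy f g)))
        ≤ ∑ f, ∑ g, sampleProb σ η l ω f g * Real.exp (∑ s, G (ω s)) :=
          Finset.sum_le_sum fun f _ => Finset.sum_le_sum fun g _ =>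
            mul_le_mul_of_nonneg_left (mul_le_of_le_one_right (Real.exp_pos _).le (hG_exp f g))
              (sampleProb_nonneg ..)
      _ = Real.exp (∑ s, G (ω s)) := by
          simp only [← Finset.sum_mul, sum_sampleProb, one_mul]

end Regular

/-! ### The exponential supermartingales -/

/-- The regression problems at step `h`: the triples `(f^{h+1}, g^{h+1}, φ)` for which `φ ∈ F_h`
is fitted to the target defined by the next-step value `V_{g,h+1}^{μ_f}`. -/
noncomputable def regressions (F : FunClass M) (h : Fin M.H) :
    Finset ((X × A × B → ℝ) × (X × A × B → ℝ) × (X × A × B → ℝ)) :=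
  stepClass F (h + 1) ×ˢ stepClass F (h + 1) ×ˢ stepClass F h

lemma mk_mem_regressions (f g : Mem F) {h : Fin M.H} {φ : X × A × B → ℝ} (hφ : φ ∈ F h) :
    (f.comp (h + 1), g.comp (h + 1), φ) ∈ regressions F h :=
  Finset.mk_mem_product (comp_mem_stepClass f _) (Finset.mk_mem_product (comp_mem_stepClass g _)
    (stepClass_fin F h ▸ hφ))

/-- The compensated negative excess loss of one episode. -/
noncomputable def gain (σ : Selector X A B) (η : ℝ) (h : Fin M.H) (v : X → ℝ)
    (φ : X × A × B → ℝ) (e : Episode F) : ℝ :=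
  -η * excessLoss h v φ e.2.2 +
    η / 2 * meanSqDev h v φ (σ.maxPolicy e.1) (σ.minPolicy e.1 e.2.1)

/-- The sum of the exponential supermartingales of all regression problems at step `h`. -/
noncomputable def expGain (σ : Selector X A B) (η : ℝ) (h : Fin M.H) {t : ℕ}
    (ω : Fin t → Episode F) : ℝ :=
  ∑ i ∈ regressions F h, Real.exp (∑ s, gain σ η h (σ.brVal (h + 1) i.1 i.2.1) i.2.2 (ω s))

/-- The logarithm of `expGain σ η h ω`, linearized at the initial value. -/
noncomputable def logPotential (σ : Selector X A B) (η : ℝ) (h : Fin M.H) {t : ℕ}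
    (ω : Fin t → Episode F) : ℝ :=
  Real.log (regressions F h).card + expGain σ η h ω / (regressions F h).card - 1

lemma card_regressions_pos (f : Mem F) (h : Fin M.H) : (0 : ℝ) < (regressions F h).card :=
  Nat.cast_pos.2 (Finset.card_pos.2 ⟨_, mk_mem_regressions f f (f h).2⟩)

lemma log_expGain_le_logPotential (f : Mem F) (η : ℝ) (h : Fin M.H) {t : ℕ}
    (ω : Fin t → Episode F) : Real.log (expGain σ η h ω) ≤ logPotential σ η h ω :=
  log_le_log_add_div_sub_one
    (Finset.sum_pos (fun _ _ => Real.exp_pos _) ⟨_, mk_mem_regressions f f (f h).2⟩)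
    (card_regressions_pos f h)

lemma sum_exp_sum_gain_le_expGain (f g : Mem F) (η : ℝ) (h : Fin M.H) {t : ℕ}
    (ω : Fin t → Episode F) :
    ∑ φ ∈ F h, Real.exp (∑ s,
      gain σ η h (inducedBrValue (σ.maxPolicy f) g (h + 1)) φ (ω s)) ≤ expGain σ η h ω := by
  calc ∑ φ ∈ F h, Real.exp (∑ s,
        gain σ η h (inducedBrValue (σ.maxPolicy f) g (h + 1)) φ (ω s))
      = ∑ i ∈ {f.comp (h + 1)} ×ˢ {g.comp (h + 1)} ×ˢ stepClass F h, Real.exp (∑ s,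
          gain σ η h (σ.brVal (h + 1) i.1 i.2.1) i.2.2 (ω s)) := by
        simp only [Finset.sum_product, Finset.sum_singleton, stepClass_fin,
          inducedBrValue_maxPolicy]
    _ ≤ expGain σ η h ω := Finset.sum_le_sum_of_subset_of_nonneg
        (Finset.product_subset_product (Finset.singleton_subset_iff.2 (comp_mem_stepClass f _))
          (Finset.product_subset_product_left
            (Finset.singleton_subset_iff.2 (comp_mem_stepClass g _))))
        fun _ _ _ => (Real.exp_pos _).le

lemma sum_gain_le_log_expGain (f g : Mem F) (η : ℝ) {h : Fin M.H} {φ : X × A × B → ℝ}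
    (hφ : φ ∈ F h) {t : ℕ} (ω : Fin t → Episode F) :
    ∑ s, gain σ η h (inducedBrValue (σ.maxPolicy f) g (h + 1)) φ (ω s) ≤
      Real.log (expGain σ η h ω) := by
  rw [← Real.log_exp (∑ s, _)]
  exact Real.log_le_log (Real.exp_pos _) ((Finset.single_le_sum
    (f := fun φ => Real.exp (∑ s, gain σ η h _ φ (ω s)))
    (fun _ _ => (Real.exp_pos _).le) hφ).trans (sum_exp_sum_gain_le_expGain f g η h ω))

lemma log_card_mem (f : Mem F) :
    Real.log (Fintype.card (Mem F)) = ∑ h ∈ Finset.range M.H, Real.log (stepClass F h).card := by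
  have card_eq : Fintype.card (Mem F) = ∏ h : Fin M.H, (F h).card :=
    (Fintype.card_pi (α := fun h : Fin M.H => {φ // φ ∈ F h})).trans
      (Finset.prod_congr rfl fun h _ => Fintype.card_coe (F h))
  rw [card_eq, Nat.cast_prod, Real.log_prod fun h _ => (card_factor_pos f h).ne',
    Finset.sum_range]
  simp only [stepClass_fin]

lemma sum_log_card_stepClass_succ_le (F : FunClass M) :
    ∑ h ∈ Finset.range M.H, Real.log (stepClass F (h + 1)).card ≤
      ∑ h ∈ Finset.range M.H, Real.log (stepClass F h).card := by
  have shift := Finset.sum_range_succ' (fun h => Real.log (stepClass F h).card) M.H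
  rw [Finset.sum_range_succ, stepClass_of_le F le_rfl, Finset.card_singleton, Nat.cast_one,
    Real.log_one, add_zero] at shift
  linarith [Real.log_natCast_nonneg (stepClass F 0).card]

lemma sum_log_card_regressions_le (f : Mem F) :
    ∑ h : Fin M.H, Real.log (regressions F h).card ≤ 3 * Real.log (Fintype.card (Mem F)) := by
  have card_ne_zero (h : ℕ) : ((stepClass F h).card : ℝ) ≠ 0 :=
    Nat.cast_ne_zero.2 (Finset.card_ne_zero_of_mem (comp_mem_stepClass f h))
  have split (h : Fin M.H) : Real.log (regressions F h).card =
      2 * Real.log (stepClass F (h + 1)).card + Real.log (stepClass F h).card := by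
    rw [regressions, Finset.card_product, Finset.card_product, Nat.cast_mul, Nat.cast_mul,
      Real.log_mul (card_ne_zero _) (mul_ne_zero (card_ne_zero _) (card_ne_zero _)),
      Real.log_mul (card_ne_zero _) (card_ne_zero _)]
    ring
  simp only [split, Finset.sum_add_distrib, ← Finset.mul_sum]
  rw [log_card_mem f, ← Finset.sum_range fun h => Real.log (stepClass F (h + 1)).card,
    ← Finset.sum_range fun h => Real.log (stepClass F h).card]
  linarith [sum_log_card_stepClass_succ_le F]

namespace Regular

variable (R : Regular F σ)

include R

section Gain

variable {h : Fin M.H} {v : X → ℝ} {φ : X × A × B → ℝ} (hv : IsStepValue M (h + 1) v)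
  (hφ : φ ∈ stepClass F h)

include hv hφ

lemma bddMeas_gain (η : ℝ) : BddMeas (gain (F := F) σ η h v φ) := by
  have hdev : BddMeas fun p : Mem F × Mem F =>
    meanSqDev h v φ (σ.maxPolicy p.1) (σ.minPolicy p.1 p.2) := .of_finite _
  exact (((hv.bddMeas_excessLoss (R.measurable_of_mem hφ) (R.mem_Icc_of_mem hφ)).comp
    (measurable_snd.comp measurable_snd)).const_mul _).add
      ((hdev.comp (u := fun e : Episode F => (e.1, e.2.1)) (by fun_prop)).const_mul _)

lemma integral_exp_gain_le_one {η : ℝ} (h0 : 0 ≤ η) (h5 : η ≤ 1 / 5) (f g : Mem F) :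
    ∫ ζ, Real.exp (gain σ η h v φ ((f, g, ζ) : Episode F))
      ∂(episodeLaw M (σ.maxPolicy f) (σ.minPolicy f g)) ≤ 1 := by
  simp only [gain, Real.exp_add, integral_mul_const]
  refine (mul_le_mul_of_nonneg_right (hv.integral_exp_excessLoss_le (R.measurable_of_mem hφ)
    (R.mem_Icc_of_mem hφ) h0 h5 _ _) (Real.exp_pos _).le).trans_eq ?_
  rw [← Real.exp_add, neg_mul, neg_add_cancel, Real.exp_zero]

end Gain

lemma isStepValue_of_mem_regressions {h : Fin M.H}
    {i : (X × A × B → ℝ) × (X × A × B → ℝ) × (X × A × B → ℝ)} (hi : i ∈ regressions F h) :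
    IsStepValue M (h + 1) (σ.brVal (h + 1) i.1 i.2.1) ∧ i.2.2 ∈ stepClass F h := by
  simp only [regressions, Finset.mem_product] at hi
  exact ⟨R.isStepValue_brVal hi.1 hi.2.1, hi.2.2⟩

lemma bddMeas_expGain (η : ℝ) (h : Fin M.H) (t : ℕ) :
    BddMeas fun ω : Fin t → Episode F => expGain σ η h ω :=
  BddMeas.sum fun _ hi => (BddMeas.sum fun s _ => have hi := R.isStepValue_of_mem_regressions hi
    (R.bddMeas_gain hi.1 hi.2 η).comp (measurable_pi_apply s)).exp

lemma bddMeas_logPotential (η : ℝ) (h : Fin M.H) (t : ℕ) :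
    BddMeas fun ω : Fin t → Episode F => logPotential σ η h ω := by
  simp only [logPotential, div_eq_inv_mul]
  exact ((BddMeas.const _).add ((R.bddMeas_expGain η h t).const_mul _)).sub (.const 1)

lemma integral_expGain_le [Nonempty (Mem F)] {η : ℝ} (h0 : 0 ≤ η) (h5 : η ≤ 1 / 5) (l : ℝ)
    (h : Fin M.H) (t : ℕ) :
    ∫ ω, expGain σ η h ω ∂(processLaw F σ η l t) ≤ (regressions F h).card := by
  have := R.isProbabilityMeasure_processLaw η l t
  have regression {i} (hi : i ∈ regressions F h) := R.isStepValue_of_mem_regressions hi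
  have hgain {i} (hi : i ∈ regressions F h) :=
    R.bddMeas_gain (regression hi).1 (regression hi).2 η
  simp only [expGain]
  rw [integral_finsetSum _ fun i hi => BddMeas.integrable (BddMeas.sum fun s _ =>
    (hgain hi).comp (measurable_pi_apply s)).exp _, Finset.cast_card]
  exact Finset.sum_le_sum fun i hi => R.integral_exp_sum_processLaw_le_one η l (hgain hi)
    (R.integral_exp_gain_le_one (regression hi).1 (regression hi).2 h0 h5) t

lemma integral_logPotential_le [Nonempty (Mem F)] {η : ℝ} (h0 : 0 ≤ η) (h5 : η ≤ 1 / 5) (l : ℝ)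
    (h : Fin M.H) (t : ℕ) :
    ∫ ω, logPotential σ η h ω ∂(processLaw F σ η l t) ≤ Real.log (regressions F h).card := by
  have := R.isProbabilityMeasure_processLaw η l t
  have hE := ((R.bddMeas_expGain η h t).integrable
    (processLaw F σ η l t)).div_const ((regressions F h).card : ℝ)
  simp only [logPotential]
  rw [integral_sub ((integrable_const _).fun_add hE) (integrable_const _),
    integral_add (integrable_const _) hE, integral_div]
  simp only [integral_const, probReal_univ, one_smul]
  linarith [div_le_one_of_le₀ (R.integral_expGain_le h0 h5 l h t) (Nat.cast_nonneg _)]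

lemma integral_sum_logPotential_le [Nonempty (Mem F)] {η : ℝ} (h0 : 0 ≤ η) (h5 : η ≤ 1 / 5)
    (l : ℝ) (t : ℕ) :
    ∫ ω, ∑ h, logPotential σ η h ω ∂(processLaw F σ η l t) ≤
      3 * Real.log (Fintype.card (Mem F)) := by
  have := R.isProbabilityMeasure_processLaw η l t
  rw [integral_finsetSum _ fun h _ => (R.bddMeas_logPotential η h t).integrable _]
  exact (Finset.sum_le_sum fun h _ => R.integral_logPotential_le h0 h5 l h t).trans
    (sum_log_card_regressions_le (Classical.arbitrary (Mem F)))

end Regular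

/-! ### Posterior bounds -/

/-- The pairs `(f_s, g_s)` that were sampled in the episodes `ω`. -/
def sampledPairs {t : ℕ} (ω : Fin t → Episode F) (s : Fin t) : Mem F × Mem F :=
  ((ω s).1, (ω s).2.1)

/-- The mean squared `𝒯^{μ_f}`-residuals of `e`, summed over the steps and over the episodes in
which the policies induced by the pairs `q` were executed. -/
noncomputable def inSampleError (σ : Selector X A B) (f e : Mem F) {t : ℕ}
    (q : Fin t → Mem F × Mem F) : ℝ :=
  ∑ h : Fin M.H, ∑ s, ∫ ζ, (residual (σ.maxPolicy f) e h (ζ h)) ^ 2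
    ∂(episodeLaw M (σ.maxPolicy (q s).1) (σ.minPolicy (q s).1 (q s).2))

lemma inSampleError_nonneg (f e : Mem F) {t : ℕ} (q : Fin t → Mem F × Mem F) :
    0 ≤ inSampleError σ f e q :=
  Finset.sum_nonneg fun _ _ => Finset.sum_nonneg fun _ _ => integral_nonneg fun _ => sq_nonneg _

lemma inSampleError_eq_sum_meanSqDev (f e : Mem F) {t : ℕ} (ω : Fin t → Episode F) :
    inSampleError σ f e (sampledPairs ω) = ∑ h : Fin M.H, ∑ s,
      meanSqDev h (inducedBrValue (σ.maxPolicy f) e (h + 1)) (e.comp h)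
        (σ.maxPolicy (ω s).1) (σ.minPolicy (ω s).1 (ω s).2.1) :=
  rfl

lemma sum_gain (η : ℝ) (h : Fin M.H) (v : X → ℝ) (φ : X × A × B → ℝ) {t : ℕ}
    (ω : Fin t → Episode F) :
    ∑ s, gain σ η h v φ (ω s) = -η * ∑ s, excessLoss h v φ (ω s).2.2 +
      η / 2 * ∑ s, meanSqDev h v φ (σ.maxPolicy (ω s).1) (σ.minPolicy (ω s).1 (ω s).2.1) := by
  rw [Finset.mul_sum, Finset.mul_sum, ← Finset.sum_add_distrib]
  rfl

/-- Completeness provides the regression target as a competitor in the conditional normalizer. -/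
lemma inSampleError_sub_le_neg_log_condProd (hC : Complete F σ) (η : ℝ) (f e : Mem F) {t : ℕ}
    (ω : Fin t → Episode F) :
    η / 2 * inSampleError σ f e (sampledPairs ω) - ∑ h, logPotential σ η h ω ≤
      -Real.log (condProd η (inducedBrValue (σ.maxPolicy f) e) e fun s => (ω s).2.2) := by
  rw [neg_log_condProd, inSampleError_eq_sum_meanSqDev, Finset.mul_sum, ← Finset.sum_sub_distrib]
  refine Finset.sum_le_sum fun h _ => ?_
  set v := inducedBrValue (σ.maxPolicy f) e
  have target_le := Real.log_le_log (Real.exp_pos _) (Finset.single_le_sum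
    (f := fun φ => Real.exp (-η * (loss M v h φ (fun s => (ω s).2.2) -
      loss M v h (e.comp h) fun s => (ω s).2.2))) (fun _ _ => (Real.exp_pos _).le) (hC f e h))
  rw [Real.log_exp] at target_le
  have excess := loss_sub_loss_target v h (e.comp h) fun s => (ω s).2.2
  have gain_le := (sum_gain_le_log_expGain (σ := σ) f e η (comp_fin e h ▸ (e h).2) ω).trans
    (log_expGain_le_logPotential f η h ω)
  rw [sum_gain, ← excess] at gain_le
  change -η * (loss M v h (target M h (v (h + 1))) _ - _) ≤ _ at target_le
  linarith

lemma neg_log_condProd_le {η : ℝ} (hη : 0 ≤ η) {f e : Mem F}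
    (he : IsBellmanFixedPoint (σ.maxPolicy f) e) {t : ℕ} (ω : Fin t → Episode F) :
    -Real.log (condProd η (inducedBrValue (σ.maxPolicy f) e) e fun s => (ω s).2.2) ≤
      ∑ h, logPotential σ η h ω := by
  rw [neg_log_condProd]
  refine Finset.sum_le_sum fun h _ => ?_
  set v := inducedBrValue (σ.maxPolicy f) e
  have target_eq : e.comp h = target M h (v (h + 1)) := he h
  refine (Real.log_le_log (Finset.sum_pos (fun _ _ => Real.exp_pos _) ⟨_, (e h).2⟩)
    ((Finset.sum_le_sum fun φ _ => Real.exp_le_exp.2 ?_).trans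
      (sum_exp_sum_gain_le_expGain f e η h ω))).trans (log_expGain_le_logPotential f η h ω)
  rw [target_eq, loss_sub_loss_target, sum_gain]
  exact le_add_of_nonneg_right (mul_nonneg (div_nonneg hη zero_le_two)
    (Finset.sum_nonneg fun _ _ => meanSqDev_nonneg ..))

/-- The common form of the posterior weights of both agents: the value estimates are tilted by `c`,
and `e` is regressed against the policy induced by `b e`, where `b = id` for the main agent and
`b` is constant for the booster agent. -/
noncomputable def tiltedWeight (σ : Selector X A B) (η c : ℝ) (b : Mem F → Mem F) {t : ℕ}
    (S : Fin t → Trajectory M) (e : Mem F) : ℝ :=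
  Real.exp (c * inducedBrValue (σ.maxPolicy (b e)) e 0 M.x₁) *
    condProd η (inducedBrValue (σ.maxPolicy (b e)) e) e S

lemma tiltedWeight_pos (η c : ℝ) (b : Mem F → Mem F) {t : ℕ} (S : Fin t → Trajectory M)
    (e : Mem F) : 0 < tiltedWeight σ η c b S e :=
  mul_pos (Real.exp_pos _) (condProd_pos ..)

/-- The `c`-weighted gap between a comparator value `v` and the estimate `V_{e,1}^{μ_f}(x^1)`,
plus the in-sample error of `e`. -/
noncomputable def penalizedGap (σ : Selector X A B) (η c v : ℝ) (f e : Mem F) {t : ℕ}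
    (q : Fin t → Mem F × Mem F) : ℝ :=
  c * (v - inducedBrValue (σ.maxPolicy f) e 0 M.x₁) + η / 2 * inSampleError σ f e q

lemma sum_normalize_tiltedWeight_mul_penalizedGap_le (hC : Complete F σ) {η : ℝ} (hη : 0 ≤ η)
    (c : ℝ) (b : Mem F → Mem F) {e : Mem F} (he : IsBellmanFixedPoint (σ.maxPolicy (b e)) e)
    {t : ℕ} (ω : Fin t → Episode F) :
    ∑ e', normalize (tiltedWeight σ η c b fun s => (ω s).2.2) e' *
        penalizedGap σ η c (inducedBrValue (σ.maxPolicy (b e)) e 0 M.x₁) (b e') e'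
          (sampledPairs ω) ≤
      2 * ∑ h, logPotential σ η h ω + Real.log (Fintype.card (Mem F)) := by
  set v := inducedBrValue (σ.maxPolicy (b e)) e 0 M.x₁ with hv
  have neg_log (e' : Mem F) : -Real.log (tiltedWeight σ η c b (fun s => (ω s).2.2) e') =
      -(c * inducedBrValue (σ.maxPolicy (b e')) e' 0 M.x₁) - Real.log (condProd η
        (inducedBrValue (σ.maxPolicy (b e')) e') e' fun s => (ω s).2.2) := by
    rw [tiltedWeight, Real.log_mul (Real.exp_pos _).ne' (condProd_pos ..).ne', Real.log_exp]
    ring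
  refine (sum_normalize_mul_le (a := c * v + ∑ h, logPotential σ η h ω)
    (b := -(c * v) + ∑ h, logPotential σ η h ω)
    (fun e' => tiltedWeight_pos η c b _ e') (fun e' => ?_) e ?_).trans_eq (by ring)
  · rw [neg_log, penalizedGap]
    linarith [inSampleError_sub_le_neg_log_condProd hC η (b e') e' ω]
  · rw [neg_log, ← hv]
    linarith [neg_log_condProd_le hη he ω]

lemma sum_boosterPosterior_mul_penalizedGap_le (hC : Complete F σ) {η : ℝ} (hη : 0 ≤ η) (l : ℝ)
    {f g : Mem F} (hg : IsBellmanFixedPoint (σ.maxPolicy f) g) {t : ℕ} (ω : Fin t → Episode F) :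
    ∑ g', boosterPosterior η l (σ.maxPolicy f) (fun s => (ω s).2.2) g' *
        penalizedGap σ η (-l) (inducedBrValue (σ.maxPolicy f) g 0 M.x₁) f g' (sampledPairs ω) ≤
      2 * ∑ h, logPotential σ η h ω + Real.log (Fintype.card (Mem F)) :=
  sum_normalize_tiltedWeight_mul_penalizedGap_le hC hη (-l) (fun _ => f) hg ω

namespace Regular

variable (R : Regular F σ)

include R

lemma mainWeight_eq_tiltedWeight (η l : ℝ) {t : ℕ} (S : Fin t → Trajectory M) :
    mainWeight η l S = tiltedWeight (F := F) σ η l id S := by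
  ext f
  rw [mainWeight, R.inducedValue_eq]
  rfl

lemma sum_mainPosterior_mul_penalizedGap_le (hC : Complete F σ) {η : ℝ} (hη : 0 ≤ η) (l : ℝ)
    {f : Mem F} (hf : IsBellmanFixedPoint (σ.maxPolicy f) f) {t : ℕ} (ω : Fin t → Episode F) :
    ∑ f', mainPosterior η l (fun s => (ω s).2.2) f' *
        penalizedGap σ η l (inducedBrValue (σ.maxPolicy f) f 0 M.x₁) f' f' (sampledPairs ω) ≤
      2 * ∑ h, logPotential σ η h ω + Real.log (Fintype.card (Mem F)) := by
  simp only [mainPosterior_eq_normalize, R.mainWeight_eq_tiltedWeight]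
  exact sum_normalize_tiltedWeight_mul_penalizedGap_le hC hη l id hf ω

end Regular

/-! ### Expected potentials along the learning process -/

lemma sampledPairs_snoc {t : ℕ} (ω : Fin t → Episode F) (f g : Mem F) (ζ : Trajectory M) :
    sampledPairs (Fin.snoc ω ((f, g, ζ) : Episode F) : Fin (t + 1) → Episode F) =
      Fin.snoc (sampledPairs ω) (f, g) := by
  ext1 s
  induction s using Fin.lastCases with
  | last => simp only [sampledPairs, Fin.snoc_last]
  | cast s => simp only [sampledPairs, Fin.snoc_castSucc]

lemma bddMeas_sampledPairs (t : ℕ) (G : (Fin t → Mem F × Mem F) → ℝ) :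
    BddMeas fun ω : Fin t → Episode F => G (sampledPairs ω) :=
  (BddMeas.of_finite G).comp (measurable_pi_iff.2 fun s => by unfold sampledPairs; fun_prop)

/-- The sum over the rounds `t` of the costs `ψ_t` of the pair `q_t` given the previous ones. -/
def sumRounds (ψ : ∀ t : ℕ, (Fin t → Mem F × Mem F) → Mem F × Mem F → ℝ) {T : ℕ}
    (q : Fin T → Mem F × Mem F) : ℝ :=
  ∑ t : Fin T, ψ t (Fin.take t t.2.le q) (q t)

lemma sumRounds_snoc (ψ : ∀ t : ℕ, (Fin t → Mem F × Mem F) → Mem F × Mem F → ℝ) {T : ℕ}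
    (q : Fin T → Mem F × Mem F) (p : Mem F × Mem F) :
    sumRounds ψ (Fin.snoc q p : Fin (T + 1) → Mem F × Mem F) = sumRounds ψ q + ψ T q p := by
  rw [sumRounds, Fin.sum_univ_castSucc]
  congr 1
  · refine Finset.sum_congr rfl fun t _ => ?_
    rw [Fin.snoc_castSucc]
    congr 1
    exact congrArg (Fin.take t t.2.le) (Fin.init_snoc (α := fun _ => Mem F × Mem F) p q)
  · rw [Fin.snoc_last]
    congr 1
    exact Fin.init_snoc ..

lemma Regular.integral_sumRounds_le (R : Regular F σ) [Nonempty (Mem F)] (η l : ℝ)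
    (ψ : ∀ t : ℕ, (Fin t → Mem F × Mem F) → Mem F × Mem F → ℝ) {c : ℝ}
    (hψ : ∀ t, ∫ ω, ∑ f : Mem F, ∑ g : Mem F,
      sampleProb σ η l ω f g * ψ t (sampledPairs ω) (f, g) ∂(processLaw F σ η l t) ≤ c) (T : ℕ) :
    ∫ ω, sumRounds ψ (sampledPairs ω) ∂(processLaw F σ η l T) ≤ T * c := by
  induction T with
  | zero => simp only [sumRounds, Finset.univ_eq_empty, Finset.sum_empty, integral_zero,
      Nat.cast_zero, zero_mul, le_refl]
  | succ T ih =>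
    have := R.isProbabilityMeasure_processLaw η l T
    have round : BddMeas fun ω : Fin T → Episode F => ∑ f : Mem F, ∑ g : Mem F,
        sampleProb σ η l ω f g * ψ T (sampledPairs ω) (f, g) :=
      .sum fun f _ => .sum fun g _ => (R.bddMeas_sampleProb η l T f g).mul
        (bddMeas_sampledPairs T fun q => ψ T q (f, g))
    rw [R.integral_processLaw_succ η l T (bddMeas_sampledPairs (T + 1) (sumRounds ψ))]
    simp only [sampledPairs_snoc, sumRounds_snoc, integral_const, probReal_univ, one_smul,
      mul_add, Finset.sum_add_distrib, ← Finset.sum_mul, sum_sampleProb, one_mul]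
    rw [integral_add ((bddMeas_sampledPairs T (sumRounds ψ)).integrable _) (round.integrable _)]
    push_cast
    linarith [hψ T]

/-- The penalized gaps of both agents in one round: `vs` bounds the estimate of the main agent
from below, and the best response value of `μ_f` that of the booster agent from above. -/
noncomputable def roundPotential (σ : Selector X A B) (η l vs : ℝ) (t : ℕ)
    (q : Fin t → Mem F × Mem F) (p : Mem F × Mem F) : ℝ :=
  penalizedGap σ η l vs p.1 p.1 q +
    penalizedGap σ η (-l) (brValue M (σ.maxPolicy p.1) 0 M.x₁) p.1 p.2 q

namespace Regular

variable (R : Regular F σ) (hC : Complete F σ)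
  (hbr : ∀ f : Mem F, ∀ h : Fin M.H, brQValue M (σ.maxPolicy f) h ∈ F h)
  {f : Mem F} (hf : IsBellmanFixedPoint (σ.maxPolicy f) f) {η : ℝ} (h0 : 0 ≤ η)

include R hC hbr hf h0

lemma sum_sampleProb_mul_roundPotential_le (l : ℝ) {t : ℕ} (ω : Fin t → Episode F) :
    ∑ f' : Mem F, ∑ g' : Mem F, sampleProb σ η l ω f' g' *
      roundPotential σ η l (inducedBrValue (σ.maxPolicy f) f 0 M.x₁) t (sampledPairs ω) (f', g') ≤
      4 * ∑ h, logPotential σ η h ω + 2 * Real.log (Fintype.card (Mem F)) := by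
  have : Nonempty (Mem F) := ⟨f⟩
  set vs := inducedBrValue (σ.maxPolicy f) f 0 M.x₁
  set L := 2 * ∑ h, logPotential σ η h ω + Real.log (Fintype.card (Mem F))
  let p (f' : Mem F) : ℝ := mainPosterior η l (fun s => (ω s).2.2) f'
  have sum_main : ∑ f', p f' = 1 :=
    sum_normalize fun f' : Mem F => mainWeight_pos η l f' _
  have main : ∑ f', p f' * penalizedGap σ η l vs f' f' (sampledPairs ω) ≤ L :=
    R.sum_mainPosterior_mul_penalizedGap_le hC h0 l hf ω
  have booster (f' : Mem F) : ∑ g' : Mem F, sampleProb σ η l ω f' g' *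
      roundPotential σ η l vs t (sampledPairs ω) (f', g') ≤
      p f' * (penalizedGap σ η l vs f' f' (sampledPairs ω) + L) := by
    obtain ⟨g, hg, hgv⟩ := R.exists_isBellmanFixedPoint_brValue f' (hbr f')
    have hgap := sum_boosterPosterior_mul_penalizedGap_le hC h0 l hg ω
    have sum_booster : ∑ g', boosterPosterior η l (σ.maxPolicy f') (fun s => (ω s).2.2) g' = 1 :=
      sum_normalize fun g' : Mem F => boosterWeight_pos η l g' _ _
    rw [hgv] at hgap
    simp only [sampleProb, mul_assoc, ← Finset.mul_sum]
    refine mul_le_mul_of_nonneg_left ?_ (normalize_pos (fun f' => mainWeight_pos η l f' _) f').le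
    simp only [roundPotential, mul_add, Finset.sum_add_distrib, ← Finset.sum_mul, sum_booster,
      one_mul]
    exact add_le_add le_rfl hgap
  refine (Finset.sum_le_sum fun f' _ => booster f').trans ?_
  simp only [mul_add, Finset.sum_add_distrib, ← Finset.sum_mul, sum_main, one_mul]
  linarith

lemma integral_sumRounds_roundPotential_le (h5 : η ≤ 1 / 5) (l : ℝ) (T : ℕ) :
    ∫ ω, sumRounds (roundPotential σ η l (inducedBrValue (σ.maxPolicy f) f 0 M.x₁))
      (sampledPairs ω) ∂(processLaw F σ η l T) ≤ T * (14 * Real.log (Fintype.card (Mem F))) := by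
  have : Nonempty (Mem F) := ⟨f⟩
  refine R.integral_sumRounds_le η l _ (fun t => ?_) T
  have := R.isProbabilityMeasure_processLaw η l t
  have potential : BddMeas fun ω : Fin t → Episode F => 4 * ∑ h, logPotential σ η h ω :=
    (BddMeas.sum fun h _ => R.bddMeas_logPotential η h t).const_mul 4
  calc _ ≤ ∫ ω, (4 * ∑ h, logPotential σ η h ω + 2 * Real.log (Fintype.card (Mem F)))
          ∂(processLaw F σ η l t) :=
        integral_mono (BddMeas.integrable (.sum fun f' _ => .sum fun g' _ =>
            (R.bddMeas_sampleProb η l t f' g').mul (bddMeas_sampledPairs t fun q =>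
              roundPotential σ η l _ t q (f', g'))) _)
          ((potential.add (.const _)).integrable _)
          fun ω => R.sum_sampleProb_mul_roundPotential_le hC hbr hf h0 l ω
    _ = 4 * ∫ ω, ∑ h, logPotential σ η h ω ∂(processLaw F σ η l t) +
          2 * Real.log (Fintype.card (Mem F)) := by
        rw [integral_add (potential.integrable _) (integrable_const _), integral_const_mul,
          integral_const, probReal_univ, one_smul]
    _ ≤ 14 * Real.log (Fintype.card (Mem F)) := by
        linarith [R.integral_sum_logPotential_le h0 h5 l t]

end Regular

/-! ### Decoupling -/

/-- The `𝒯^{μ_f}`-residuals of `e` along the episode executed after sampling the pair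
`p = (f, g)`. -/
noncomputable def onPolicyResidual (σ : Selector X A B) (p : Mem F × Mem F) (e : Mem F) : ℝ :=
  ∑ h : Fin M.H, ∫ ζ, residual (σ.maxPolicy p.1) e h (ζ h)
    ∂(episodeLaw M (σ.maxPolicy p.1) (σ.minPolicy p.1 p.2))

lemma decouplingIneq_iff {T : ℕ} {m K : ℝ} (p : ℕ → Mem F × Mem F) (e : Mem F × Mem F → Mem F) :
    DecouplingIneq σ T m K (fun t => (p t).1) (fun t => (p t).2) (fun t => e (p t)) ↔
      |∑ t : Fin T, onPolicyResidual σ (p t) (e (p t))| ≤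
        m * ∑ t : Fin T, inSampleError σ (p t).1 (e (p t)) (fun s : Fin t => p s) +
          K / (4 * m) := by
  simp only [DecouplingIneq, onPolicyResidual, inSampleError, Finset.sum_range,
    Finset.sum_comm (s := Finset.univ (α := Fin T))]

namespace Regular

variable (R : Regular F σ)

include R

lemma abs_onPolicyResidual_le (p : Mem F × Mem F) (e : Mem F) :
    |onPolicyResidual σ p e| ≤ M.H * 2 := by
  have step (h : Fin M.H) : |∫ ζ, residual (σ.maxPolicy p.1) e h (ζ h)
      ∂(episodeLaw M (σ.maxPolicy p.1) (σ.minPolicy p.1 p.2))| ≤ 2 := by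
    have residual_le (s : X × A × B) : ‖residual (σ.maxPolicy p.1) e h s‖ ≤ 2 :=
      (R.isStepValue_inducedBrValue p.1 e (h + 1)).abs_sub_target_le
        (R.mem_Icc_of_mem (comp_mem_stepClass e h)) s
    simpa only [Real.norm_eq_abs, probReal_univ, mul_one] using norm_integral_le_of_norm_le_const
      (μ := episodeLaw M (σ.maxPolicy p.1) (σ.minPolicy p.1 p.2))
      (ae_of_all _ fun ζ => residual_le (ζ h))
  refine (Finset.abs_sum_le_sum_abs _ _).trans ((Finset.sum_le_sum fun h _ => step h).trans_eq ?_)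
  rw [Finset.sum_const, Finset.card_univ, Fintype.card_fin, nsmul_eq_mul]

lemma exists_decouplingIneq (T : ℕ) {m : ℝ} (hm : 0 < m) :
    ∃ K : ℕ, ∀ (p : ℕ → Mem F × Mem F) (e : Mem F × Mem F → Mem F),
      DecouplingIneq σ T m K (fun t => (p t).1) (fun t => (p t).2) (fun t => e (p t)) := by
  obtain ⟨K, hK⟩ := exists_nat_ge (T * (M.H * 2) * (4 * m))
  refine ⟨K, fun p e => (decouplingIneq_iff p e).2 ?_⟩
  calc |∑ t : Fin T, onPolicyResidual σ (p t) (e (p t))|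
      ≤ ∑ t : Fin T, (M.H * 2 : ℝ) := (Finset.abs_sum_le_sum_abs _ _).trans
        (Finset.sum_le_sum fun t _ => R.abs_onPolicyResidual_le _ _)
    _ = T * (M.H * 2) := by
        rw [Finset.sum_const, Finset.card_univ, Fintype.card_fin, nsmul_eq_mul]
    _ ≤ K / (4 * m) := (le_div_iff₀ (by positivity)).2 hK
    _ ≤ _ := le_add_of_nonneg_left (mul_nonneg hm.le
        (Finset.sum_nonneg fun t _ => inSampleError_nonneg _ _ _))

/-- Since some integer satisfies the decoupling inequalities, so does `dc`, which as the infimum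
of an empty set would be `0`. -/
lemma decouplingIneq_dc (T : ℕ) {m : ℝ} (hm : 0 < m) (f g : ℕ → Mem F) :
    DecouplingIneq σ T m (dc F σ T m) f g f ∧ DecouplingIneq σ T m (dc F σ T m) f g g := by
  obtain ⟨K, hK⟩ := R.exists_decouplingIneq T hm
  exact Nat.sInf_mem (s := {K : ℕ | ∀ f g : ℕ → Mem F,
    DecouplingIneq σ T m K f g f ∧ DecouplingIneq σ T m K f g g})
    ⟨K, fun f g => ⟨hK (fun t => (f t, g t)) Prod.fst, hK (fun t => (f t, g t)) Prod.snd⟩⟩ f g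

lemma abs_sum_onPolicyResidual_le {T : ℕ} {m : ℝ} (hm : 0 < m) (q : Fin T → Mem F × Mem F)
    {e : Mem F × Mem F → Mem F} (he : e = Prod.fst ∨ e = Prod.snd) :
    |∑ t, onPolicyResidual σ (q t) (e (q t))| ≤
      m * ∑ t, inSampleError σ (q t).1 (e (q t)) (Fin.take t t.2.le q) +
        dc F σ T m / (4 * m) := by
  cases T with
  | zero =>
    simp only [Finset.univ_eq_empty, Finset.sum_empty, abs_zero, mul_zero, zero_add]
    exact div_nonneg (Nat.cast_nonneg _) (by linarith)
  | succ T =>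
    let p (t : ℕ) : Mem F × Mem F := q (Fin.ofNat (T + 1) t)
    have p_eq (t : Fin (T + 1)) : p t = q t := congrArg q (Fin.ofNat_val_eq_self t)
    have past_eq (t : Fin (T + 1)) : (fun s : Fin t => p s) = Fin.take t t.2.le q :=
      funext fun s => p_eq (s.castLE t.2.le)
    obtain ⟨hfst, hsnd⟩ := R.decouplingIneq_dc (T + 1) hm (fun t => (p t).1) (fun t => (p t).2)
    have decoupling : DecouplingIneq σ (T + 1) m (dc F σ (T + 1) m) (fun t => (p t).1)
        (fun t => (p t).2) (fun t => e (p t)) := by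
      obtain rfl | rfl := he
      exacts [hfst, hsnd]
    simpa only [p_eq, past_eq] using (decouplingIneq_iff p e).1 decoupling

end Regular

/-! ### Regret -/

lemma sumRounds_roundPotential (η l vs : ℝ) {T : ℕ} (q : Fin T → Mem F × Mem F) :
    sumRounds (roundPotential σ η l vs) q =
      l * ∑ t, ((vs - inducedBrValue (σ.maxPolicy (q t).1) (q t).1 0 M.x₁) +
        (inducedBrValue (σ.maxPolicy (q t).1) (q t).2 0 M.x₁ -
          brValue M (σ.maxPolicy (q t).1) 0 M.x₁)) +
      η / 2 * (∑ t, inSampleError σ (q t).1 (q t).1 (Fin.take t t.2.le q) +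
        ∑ t, inSampleError σ (q t).1 (q t).2 (Fin.take t t.2.le q)) := by
  rw [← Finset.sum_add_distrib, Finset.mul_sum, Finset.mul_sum, ← Finset.sum_add_distrib]
  refine Finset.sum_congr rfl fun t _ => ?_
  rw [roundPotential, penalizedGap, penalizedGap]
  ring

lemma bddMeas_regret (vs : ℝ) (T : ℕ) : BddMeas fun ω : Fin T → Episode F =>
    ∑ t, (vs - brValue M (σ.maxPolicy (ω t).1) 0 M.x₁) :=
  bddMeas_sampledPairs T fun q => ∑ t, (vs - brValue M (σ.maxPolicy (q t).1) 0 M.x₁)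

namespace Regular

variable (R : Regular F σ)

include R

lemma sub_brValue_le (vs : ℝ) (p : Mem F × Mem F) :
    vs - brValue M (σ.maxPolicy p.1) 0 M.x₁ ≤
      (vs - inducedBrValue (σ.maxPolicy p.1) p.1 0 M.x₁) +
        (inducedBrValue (σ.maxPolicy p.1) p.2 0 M.x₁ - brValue M (σ.maxPolicy p.1) 0 M.x₁) +
        (onPolicyResidual σ p p.1 - onPolicyResidual σ p p.2) := by
  have main := R.inducedBrValue_sub_value_le p.1 p.1 (σ.minPolicy p.1 p.2)
  have booster := R.inducedBrValue_sub_value_minPolicy p.1 p.2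
  unfold onPolicyResidual
  linarith

section Decoupled

variable {η : ℝ} (h0 : 0 < η) {l : ℝ} (hl : η / 2 ≤ l) {T : ℕ} {D : ℝ}
  (hD : ∀ m : ℝ, 0 < m → m ≤ 1 → (dc F σ T m : ℝ) ≤ D)

include h0 hl hD

/-- The choice `m = η / (2 l)` gives the in-sample errors the weight that they have in the
potentials. -/
lemma mul_sum_onPolicyResidual_sub_le (q : Fin T → Mem F × Mem F) :
    l * ∑ t, (onPolicyResidual σ (q t) (q t).1 - onPolicyResidual σ (q t) (q t).2) ≤
      η / 2 * (∑ t, inSampleError σ (q t).1 (q t).1 (Fin.take t t.2.le q) +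
        ∑ t, inSampleError σ (q t).1 (q t).2 (Fin.take t t.2.le q)) + l ^ 2 * D / η := by
  have hl0 : 0 < l := by linarith
  obtain ⟨m, hm⟩ : ∃ m, m = η / (2 * l) := ⟨_, rfl⟩
  have hm0 : 0 < m := hm ▸ by positivity
  have hm1 : m ≤ 1 := hm ▸ (div_le_one (by positivity)).2 (by linarith)
  have main := (le_abs_self _).trans (R.abs_sum_onPolicyResidual_le hm0 q (.inl rfl))
  have booster := (neg_le_abs _).trans (R.abs_sum_onPolicyResidual_le hm0 q (.inr rfl))
  rw [Finset.sum_sub_distrib]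
  calc _ ≤ l * (m * (∑ t, inSampleError σ (q t).1 (q t).1 (Fin.take t t.2.le q) +
        ∑ t, inSampleError σ (q t).1 (q t).2 (Fin.take t t.2.le q)) +
          2 * (dc F σ T m / (4 * m))) := by gcongr; linarith
    _ ≤ l * (m * (∑ t, inSampleError σ (q t).1 (q t).1 (Fin.take t t.2.le q) +
        ∑ t, inSampleError σ (q t).1 (q t).2 (Fin.take t t.2.le q)) +
          2 * (D / (4 * m))) := by gcongr; exact hD m hm0 hm1
    _ = _ := by rw [hm]; field_simp; ring

lemma mul_sum_sub_brValue_le (vs : ℝ) (q : Fin T → Mem F × Mem F) :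
    l * ∑ t, (vs - brValue M (σ.maxPolicy (q t).1) 0 M.x₁) ≤
      sumRounds (roundPotential σ η l vs) q + l ^ 2 * D / η := by
  have residuals := R.mul_sum_onPolicyResidual_sub_le h0 hl hD q
  have rounds := mul_le_mul_of_nonneg_left
    (Finset.sum_le_sum fun t (_ : t ∈ Finset.univ) => R.sub_brValue_le vs (q t))
    (by linarith : 0 ≤ l)
  rw [Finset.sum_add_distrib, mul_add] at rounds
  rw [sumRounds_roundPotential]
  linarith

end Decoupled

section Nash

variable {μs : Policy X A} {νs : Policy X B} (hN : IsNash M μs νs)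
  (hreal : Realizable F σ μs νs)

include hN hreal

lemma mul_expectedRegret_le (hC : Complete F σ) {η : ℝ} (h0 : 0 < η) (h5 : η ≤ 1 / 5) {l : ℝ}
    (hl : η / 2 ≤ l) {T : ℕ} {D : ℝ} (hD : ∀ m : ℝ, 0 < m → m ≤ 1 → (dc F σ T m : ℝ) ≤ D) :
    l * expectedRegret F σ μs νs η l T ≤
      T * (14 * Real.log (Fintype.card (Mem F))) + l ^ 2 * D / η := by
  obtain ⟨f, hf, hfv⟩ := R.exists_isBellmanFixedPoint_nashValue hN fun h => (hreal h).1
  have : Nonempty (Mem F) := ⟨f⟩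
  have := R.isProbabilityMeasure_processLaw η l T
  have potential := (bddMeas_sampledPairs T (sumRounds (roundPotential σ η l
    (value M μs νs 0 M.x₁)))).integrable (processLaw F σ η l T)
  calc l * expectedRegret F σ μs νs η l T
      = ∫ ω, l * ∑ t, (value M μs νs 0 M.x₁ - brValue M (σ.maxPolicy (ω t).1) 0 M.x₁)
          ∂(processLaw F σ η l T) := (integral_const_mul _ _).symm
    _ ≤ ∫ ω, (sumRounds (roundPotential σ η l (value M μs νs 0 M.x₁)) (sampledPairs ω) +
          l ^ 2 * D / η) ∂(processLaw F σ η l T) :=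
        integral_mono (((bddMeas_regret _ T).const_mul l).integrable _)
          (potential.add (integrable_const _))
          fun ω => R.mul_sum_sub_brValue_le h0 hl hD _ (sampledPairs ω)
    _ = ∫ ω, sumRounds (roundPotential σ η l (value M μs νs 0 M.x₁)) (sampledPairs ω)
          ∂(processLaw F σ η l T) + l ^ 2 * D / η := by
        rw [integral_add potential (integrable_const _), integral_const, probReal_univ, one_smul]
    _ ≤ _ := by
        rw [← hfv]
        gcongr
        exact R.integral_sumRounds_roundPotential_le hC (fun f h => (hreal h).2 f) hf h0.le h5 l T

lemma expectedRegret_le (η l : ℝ) (T : ℕ) : expectedRegret F σ μs νs η l T ≤ T := by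
  obtain ⟨f, -, hfv⟩ := R.exists_isBellmanFixedPoint_nashValue hN fun h => (hreal h).1
  have : Nonempty (Mem F) := ⟨f⟩
  have := R.isProbabilityMeasure_processLaw η l T
  have regret_le_one (f' : Mem F) :
      value M μs νs 0 M.x₁ - brValue M (σ.maxPolicy f') 0 M.x₁ ≤ 1 := by
    have value_le_one := ((R.isStepValue_inducedBrValue f f 0).mem_Icc M.x₁).2
    rw [hfv] at value_le_one
    linarith [brValue_nonneg M (σ.maxPolicy f') 0 M.x₁]
  calc expectedRegret F σ μs νs η l T
      ≤ ∫ _, (∑ _t : Fin T, 1 : ℝ) ∂(processLaw F σ η l T) :=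
        integral_mono ((bddMeas_regret _ T).integrable _) (integrable_const _)
          fun ω => Finset.sum_le_sum fun t _ => regret_le_one (ω t).1
    _ = T := by
        rw [integral_const, probReal_univ, one_smul, Finset.sum_const, Finset.card_univ,
          Fintype.card_fin, nsmul_one]

lemma expectedRegret_eq_zero [Subsingleton (Mem F)] (η l : ℝ) (T : ℕ) :
    expectedRegret F σ μs νs η l T = 0 := by
  obtain ⟨f, -, hfv⟩ := R.exists_isBellmanFixedPoint_nashValue hN fun h => (hreal h).1
  have regret_eq_zero (f' : Mem F) :
      value M μs νs 0 M.x₁ - brValue M (σ.maxPolicy f') 0 M.x₁ = 0 := by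
    obtain ⟨g, -, hgv⟩ := R.exists_isBellmanFixedPoint_brValue f' fun h => (hreal h).2 f'
    rw [← hfv, ← hgv, Subsingleton.elim g f', Subsingleton.elim f f', sub_self]
  simp only [expectedRegret, regret_eq_zero, Finset.sum_const_zero, integral_zero]

lemma expectedRegret_le_two_mul_log (η l : ℝ) (T : ℕ) :
    expectedRegret F σ μs νs η l T ≤ 2 * (T * Real.log (Fintype.card (Mem F))) := by
  obtain hcard | hcard := Nat.lt_or_ge 1 (Fintype.card (Mem F))
  · have log_ge : 1 / 2 ≤ Real.log (Fintype.card (Mem F)) := by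
      linarith [Real.log_two_gt_d9, Real.log_le_log two_pos
        (by exact_mod_cast hcard : (2 : ℝ) ≤ Fintype.card (Mem F))]
    calc expectedRegret F σ μs νs η l T ≤ T * 1 :=
          (R.expectedRegret_le hN hreal η l T).trans_eq (mul_one _).symm
      _ ≤ T * (2 * Real.log (Fintype.card (Mem F))) := by gcongr; linarith
      _ = _ := by ring
  · have := Fintype.card_le_one_iff_subsingleton.1 hcard
    rw [R.expectedRegret_eq_zero hN hreal]
    have := Real.log_natCast_nonneg (Fintype.card (Mem F))
    positivity

end Nash

end Regular

end ZeroSumMG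

theorem mainTheorem5_general {X A B : Type*} [MeasurableSpace X] [MeasurableSpace A]
    [MeasurableSpace B] {M : MarkovGame X A B} {F : FunClass M} {σ : Selector X A B}
    {μs : Policy X A} {νs : Policy X B} {T : ℕ} {D η : ℝ} (hN : IsNash M μs νs)
    (hopt : σ.IsOptimal F) (hmeas : ∀ h : Fin M.H, ∀ φ ∈ F h, Measurable φ)
    (hreal : Realizable F σ μs νs) (hC : Complete F σ) (hbdd : BoundedBy F 2) (hD : 0 < D)
    (hdc : ∀ m : ℝ, 0 < m → m ≤ 1 → (dc F σ T m : ℝ) ≤ D) (h0 : 0 < η) (h5 : η ≤ 1 / 5) :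
    expectedRegret F σ μs νs η (Real.sqrt (T * Real.log (Fintype.card (Mem F)) / D)) T ≤
      (14 + 1 / η) * Real.sqrt (D * T * Real.log (Fintype.card (Mem F))) := by
  have R : Regular F σ := ⟨hopt, hmeas, hbdd⟩
  have := Real.log_natCast_nonneg (Fintype.card (Mem F))
  set l := Real.sqrt (T * Real.log (Fintype.card (Mem F)) / D) with hl
  have : 0 ≤ l := Real.sqrt_nonneg _
  have mul_log : T * Real.log (Fintype.card (Mem F)) = l ^ 2 * D := by
    rw [hl, Real.sq_sqrt (by positivity), div_mul_cancel₀ _ hD.ne']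
  have sqrt_eq : Real.sqrt (D * T * Real.log (Fintype.card (Mem F))) = l * D := by
    rw [mul_assoc, mul_log, show D * (l ^ 2 * D) = (l * D) ^ 2 by ring,
      Real.sqrt_sq (by positivity)]
  rw [sqrt_eq]
  obtain large | small := le_or_gt (η / 2) l
  · refine le_of_mul_le_mul_left ?_ (by linarith : 0 < l)
    calc _ ≤ T * (14 * Real.log (Fintype.card (Mem F))) + l ^ 2 * D / η :=
          R.mul_expectedRegret_le hN hreal hC h0 h5 large hdc
      _ = l * ((14 + 1 / η) * (l * D)) := by linear_combination 14 * mul_log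
  · calc _ ≤ 2 * (l ^ 2 * D) := mul_log ▸ R.expectedRegret_le_two_mul_log hN hreal η l T
      _ = 2 * l * (l * D) := by ring
      _ ≤ (14 + 1 / η) * (l * D) := by
          gcongr
          linarith [one_div_pos.2 h0]

theorem mainTheorem5 :
    ∃ C : ℝ, 0 < C ∧
      ∀ (X : Type*) (A : Type*) (B : Type*) [MeasurableSpace X] [MeasurableSpace A]
        [MeasurableSpace B] (M : MarkovGame X A B) (F : FunClass M) (σ : Selector X A B)
        (μs : Policy X A) (νs : Policy X B) (T : ℕ) (D : ℝ),
        IsNash M μs νs →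
        σ.IsOptimal F →
        (∀ h : Fin M.H, ∀ φ ∈ F h, Measurable φ) →
        Realizable F σ μs νs →
        Complete F σ →
        BoundedBy F 2 →
        0 < D →
        (∀ m : ℝ, 0 < m → m ≤ 1 → (dc F σ T m : ℝ) ≤ D) →
        expectedRegret F σ μs νs (1 / 10)
            (Real.sqrt (T * Real.log (Fintype.card (Mem F)) / D)) T ≤
          C * Real.sqrt (D * T * Real.log (Fintype.card (Mem F))) :=
  ⟨14 + 1 / (1 / 10), by norm_num, fun _ _ _ _ _ _ _ _ _ _ _ _ _ hN hopt hmeas hreal hC hbdd hD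
    hdc => mainTheorem5_general hN hopt hmeas hreal hC hbdd hD hdc (by norm_num) (by norm_num)⟩
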